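/- Let $L>0$, let $a,b,c,\lambda>0$ be constants, and let $p\in L^1[0,L]$ be nonnegative with $p\not\equiv 0$ (that is, $p$ is not a.e. zero). Consider the Melan problem $$w''''(x)-\Big(a+b\int_0^L w\,dt\Big)w''(x)+c\int_0^L w\,dt=p(x)\ \text{ for a.e. }x\in(0,L),\qquad w(0)=w(L)=w''(0)=w''(L)=0, \tag{1}$$ whose solutions are sought in $W^{4,1}[0,L]$. Put $$\sigma(z)=\frac{3z^3}{6z\cosh z+6z-12\sinh z-z^3}\quad(z>0),\qquad M=a+\frac{2b\lambda L}{\pi},\qquad N=c+\frac{b\lambda\pi^2}{L^2},\qquad \beta(x)=\lambda\sin\frac{\pi x}{L},$$ and let $[0,\beta]=\{u\in C^2[0,L]: 0\le u\le\beta,\ 0\ge u''\ge\beta''\text{ on }[0,L]\}$. Assume that $$p(x)\le\Big[\lambda\frac{\pi^4}{L^4}+a\lambda\frac{\pi^2}{L^2}+2b\lambda^2\frac{\pi}{L}\Big]\sin\frac{\pi x}{L}+2\lambda c\frac{L}{\pi}\ \text{ for a.e. }x\in(0,L),\qquad N\le\frac{4M}{L^3}\,\sigma(\sqrt M\,L),$$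 and $$\lambda\frac{L^3}{4}\Big[\frac{2b}{\pi}+\frac{b\pi^2}{4}\Big]\le 1 .$$ Then (1) has exactly one solution $y$ in $[0,\beta]$, and $y>0$ on $(0,L)$. Moreover, for every initial function $u_0\in[0,\beta]$ (in particular for $u_0\equiv 0$ and for $u_0=\beta$) the iteration $$u_n''''-Mu_n''+N\int_0^L u_n\,dt=p+b\,u_{n-1}''\int_0^L u_{n-1}\,dt-\frac{2b\lambda L}{\pi}u_{n-1}''+\frac{b\lambda\pi^2}{L^2}\int_0^L u_{n-1}\,dt\ \text{ a.e. in }(0,L),$$ $$u_n(0)=u_n(L)=u_n''(0)=u_n''(L)=0,\qquad n=1,2,\dots,$$ determines a unique sequence $u_n\in W^{4,1}[0,L]$ $(n\ge1)$, and $u_n\to y$ uniformly on $[0,L]$. -/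

import Mathlib

open Set Filter Topology MeasureTheory

noncomputable section

namespace Melan

/-- The `k`-th derivative of `u` on `[0, L]` (one-sided at the end points). -/
def D (L : ℝ) (k : ℕ) (u : ℝ → ℝ) : ℝ → ℝ :=
  iteratedDerivWithin k u (Icc 0 L)

/-- `u ∈ W^{4,1}[0, L]`, in its usual one-dimensional description: `u` (its continuous
representative) is `C³` on `[0, L]` and its third derivative is absolutely continuous there;
the fourth derivative then exists almost everywhere and is integrable. -/
structure MemW41 (L : ℝ) (u : ℝ → ℝ) : Prop where
  contDiffOn : ContDiffOn ℝ 3 u (Icc 0 L)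
  absCont : AbsolutelyContinuousOnInterval (D L 3 u) 0 L

/-- The hinged (Navier) boundary conditions `u(0) = u(L) = u''(0) = u''(L) = 0`. -/
def NavierBC (L : ℝ) (u : ℝ → ℝ) : Prop :=
  u 0 = 0 ∧ u L = 0 ∧ D L 2 u 0 = 0 ∧ D L 2 u L = 0

/-- `w ∈ W^{4,1}[0, L]` solves the Melan problem
`w'''' - (a + b ∫ w) w'' + c ∫ w = p` a.e. in `(0, L)`, with Navier boundary conditions. -/
structure IsSolution (L a b c : ℝ) (p w : ℝ → ℝ) : Prop where
  mem : MemW41 L w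
  bc : NavierBC L w
  eqn : ∀ᵐ x ∂(volume.restrict (Ioo 0 L)),
    D L 4 w x - (a + b * ∫ t in (0 : ℝ)..L, w t) * D L 2 w x + c * (∫ t in (0 : ℝ)..L, w t) = p x

/-- The function `σ(z) = 3 z³ / (6 z cosh z + 6 z - 12 sinh z - z³)`. -/
def sigma (z : ℝ) : ℝ :=
  3 * z ^ 3 / (6 * z * Real.cosh z + 6 * z - 12 * Real.sinh z - z ^ 3)

/-- The sector `[α, β] = {u ∈ C²[0, L] : α ≤ u ≤ β, α'' ≥ u'' ≥ β''}`. -/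
def Sector (L : ℝ) (α β : ℝ → ℝ) : Set (ℝ → ℝ) :=
  {u | ContDiffOn ℝ 2 u (Icc 0 L) ∧ ∀ x ∈ Icc 0 L,
    (α x ≤ u x ∧ u x ≤ β x) ∧ (D L 2 u x ≤ D L 2 α x ∧ D L 2 β x ≤ D L 2 u x)}

/-- The function `λ sin(π x / L)`. -/
def sineArc (L lam : ℝ) : ℝ → ℝ := fun x => lam * Real.sin (Real.pi / L * x)

/-- `v` is obtained from `u` by one step of the iteration: `v ∈ W^{4,1}[0, L]` satisfies
`v'''' - (a + 2bλL/π) v'' + (c + bλπ²/L²) ∫ v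
  = p + b u'' ∫ u - (2bλL/π) u'' + (bλπ²/L²) ∫ u` a.e. in `(0, L)`,
with Navier boundary conditions. -/
structure IsStep (L a b c lam : ℝ) (p u v : ℝ → ℝ) : Prop where
  mem : MemW41 L v
  bc : NavierBC L v
  eqn : ∀ᵐ x ∂(volume.restrict (Ioo 0 L)),
    D L 4 v x - (a + 2 * b * lam * (L / Real.pi)) * D L 2 v x
        + (c + b * lam * (Real.pi ^ 2 / L ^ 2)) * (∫ t in (0 : ℝ)..L, v t)
      = p x + b * D L 2 u x * (∫ t in (0 : ℝ)..L, u t)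
        - 2 * b * lam * (L / Real.pi) * D L 2 u x
        + b * lam * (Real.pi ^ 2 / L ^ 2) * (∫ t in (0 : ℝ)..L, u t)

/-- The sequence `u` is produced by the iteration with initial function `u₀`. -/
structure IsIteration (L a b c lam : ℝ) (p u₀ : ℝ → ℝ) (u : ℕ → ℝ → ℝ) : Prop where
  init : u 0 = u₀
  step : ∀ n, IsStep L a b c lam p (u n) (u (n + 1))

/-- The iteration with initial function `u₀` is well defined (it produces exactly one sequence
of functions on `[0, L]`) and converges to `y` uniformly on `[0, L]`. -/
structure IterationConverges (L a b c lam : ℝ) (p u₀ y : ℝ → ℝ) : Prop where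
  exists_seq : ∃ u, IsIteration L a b c lam p u₀ u
  unique_seq : ∀ u v, IsIteration L a b c lam p u₀ u → IsIteration L a b c lam p u₀ v →
    ∀ n, EqOn (u n) (v n) (Icc 0 L)
  tendsto : ∀ u, IsIteration L a b c lam p u₀ u → TendstoUniformlyOn u y atTop (Icc 0 L)

end Melan

end

/-!
Write `m² = M`. Under Navier conditions `-u''` is recovered from `u'''' - M u'' + N ∫ u` by an
integral kernel: Green's function of `-y'' + m² y` minus a rank-one term. Both are compared with
products of hyperbolic sines, and `N ≤ 4 M σ(m L) / L³` turns out to be what makes the kernel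
nonnegative. The operator then obeys a comparison principle for the order given by `u ≤ v` and
`u'' ≥ v''`, in which `[0, β]` is an interval.

The right-hand side of the iteration is monotone in this order, and `0` and `β` are a lower and an
upper solution. So the iterates starting from `0` increase, those starting from `β` decrease, and
they converge to solutions `y ≤ z` of the Melan problem. For two such ordered solutions the
difference of the equations gives the opposite inequality as well, whence `y = z`. Every other
iteration in `[0, β]` is squeezed between these two, and a solution in `[0, β]` is itself a constant
iteration, which gives uniqueness.
-/

noncomputable section

namespace Melan

variable {L : ℝ}

/-! ### Carathéodory second derivatives -/

/-- The function `y` has the second derivative `y₂` on `[0, L]` in the Carathéodory sense: `y` and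
`y₁` are absolutely continuous, and `y' = y₁`, `y₁' = y₂` almost everywhere in `(0, L)`. -/
structure HasSecondDeriv (L : ℝ) (y y₁ y₂ : ℝ → ℝ) : Prop where
  absCont : AbsolutelyContinuousOnInterval y 0 L
  absCont_deriv : AbsolutelyContinuousOnInterval y₁ 0 L
  hasDerivAt : ∀ᵐ x ∂(volume.restrict (Ioo 0 L)), HasDerivAt y (y₁ x) x
  hasDerivAt_deriv : ∀ᵐ x ∂(volume.restrict (Ioo 0 L)), HasDerivAt y₁ (y₂ x) x

/-- A Carathéodory second derivative together with the Dirichlet conditions `y(0) = y(L) = 0`. -/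
structure HasDirichletSecondDeriv (L : ℝ) (y y₁ y₂ : ℝ → ℝ) : Prop
    extends HasSecondDeriv L y y₁ y₂ where
  left_eq_zero : y 0 = 0
  right_eq_zero : y L = 0

theorem integral_congr_ae_Ioo {α β : ℝ} {f g : ℝ → ℝ} (hα : 0 ≤ α) (hαβ : α ≤ β) (hβ : β ≤ L)
    (h : ∀ᵐ x ∂(volume.restrict (Ioo 0 L)), f x = g x) :
    ∫ x in α..β, f x = ∫ x in α..β, g x := by
  refine intervalIntegral.integral_congr_ae_restrict ?_
  rw [uIoc_of_le hαβ, ← restrict_Ioo_eq_restrict_Ioc]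
  exact ae_mono (Measure.restrict_mono (Ioo_subset_Ioo hα hβ) le_rfl) h

theorem intervalIntegrable_congr_ae_Ioo {f g : ℝ → ℝ} (hL : 0 ≤ L)
    (hf : IntervalIntegrable f volume 0 L)
    (h : ∀ᵐ x ∂(volume.restrict (Ioo 0 L)), f x = g x) : IntervalIntegrable g volume 0 L := by
  rw [intervalIntegrable_iff_integrableOn_Ioo_of_le hL] at *
  exact hf.congr h

theorem integral_kernel_mono {k f g : ℝ → ℝ} (hL : 0 ≤ L) (hk : ContinuousOn k (Icc 0 L))
    (hk0 : ∀ s ∈ Icc 0 L, 0 ≤ k s) (hf : IntervalIntegrable f volume 0 L)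
    (hg : IntervalIntegrable g volume 0 L)
    (h : ∀ᵐ x ∂(volume.restrict (Ioo 0 L)), f x ≤ g x) :
    ∫ s in (0 : ℝ)..L, k s * f s ≤ ∫ s in (0 : ℝ)..L, k s * g s := by
  rw [← uIcc_of_le hL] at hk
  refine intervalIntegral.integral_mono_ae_restrict hL (hf.continuousOn_mul hk)
    (hg.continuousOn_mul hk) ?_
  rw [← Measure.restrict_congr_set Ioo_ae_eq_Icc]
  filter_upwards [h, ae_restrict_mem measurableSet_Ioo] with x hx hmem
  exact mul_le_mul_of_nonneg_left hx (hk0 x (Ioo_subset_Icc_self hmem))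

theorem contDiff_succ_of_hasDerivAt {n : ℕ} {f f' : ℝ → ℝ} (h : ∀ x, HasDerivAt f (f' x) x)
    (hf' : ContDiff ℝ n f') : ContDiff ℝ (n + 1 : ℕ) f := by
  have hderiv : deriv f = f' := funext fun x => (h x).deriv
  push_cast
  exact contDiff_succ_iff_deriv.2 ⟨fun x => (h x).differentiableAt, by simp, hderiv ▸ hf'⟩

theorem HasSecondDeriv.of_hasDerivAt {q q₁ q₂ : ℝ → ℝ}
    (h₀ : ∀ x, HasDerivAt q (q₁ x) x) (h₁ : ∀ x, HasDerivAt q₁ (q₂ x) x) (h₂ : Continuous q₂) :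
    HasSecondDeriv L q q₁ q₂ := by
  have hq₁ : ContDiff ℝ (1 : ℕ) q₁ := contDiff_succ_of_hasDerivAt h₁ (contDiff_zero.2 h₂)
  have hq : ContDiff ℝ (2 : ℕ) q := contDiff_succ_of_hasDerivAt h₀ hq₁
  exact ⟨(hq.of_le (by norm_num)).contDiffOn.absolutelyContinuousOnInterval,
    hq₁.contDiffOn.absolutelyContinuousOnInterval, Eventually.of_forall h₀, Eventually.of_forall h₁⟩

namespace HasSecondDeriv

variable {y y₁ y₂ q q₁ q₂ : ℝ → ℝ}

theorem continuousOn (hL : 0 ≤ L) (hy : HasSecondDeriv L y y₁ y₂) : ContinuousOn y (Icc 0 L) := by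
  simpa only [uIcc_of_le hL] using hy.absCont.continuousOn

theorem intervalIntegrable (hy : HasSecondDeriv L y y₁ y₂) : IntervalIntegrable y volume 0 L :=
  hy.absCont.continuousOn.intervalIntegrable

theorem intervalIntegrable_deriv₂ (hL : 0 ≤ L) (hy : HasSecondDeriv L y y₁ y₂) :
    IntervalIntegrable y₂ volume 0 L := by
  refine intervalIntegrable_congr_ae_Ioo hL hy.absCont_deriv.intervalIntegrable_deriv ?_
  filter_upwards [hy.hasDerivAt_deriv] with x hx using hx.deriv

/-- Lagrange's identity. -/
theorem integral_mul_deriv₂_sub (hy : HasSecondDeriv L y y₁ y₂) (hq : HasSecondDeriv L q q₁ q₂)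
    {α β : ℝ} (hα : 0 ≤ α) (hαβ : α ≤ β) (hβ : β ≤ L) :
    ∫ x in α..β, (y x * q₂ x - y₂ x * q x)
      = (y β * q₁ β - y₁ β * q β) - (y α * q₁ α - y₁ α * q α) := by
  have hac : AbsolutelyContinuousOnInterval (fun x => y x * q₁ x - y₁ x * q x) α β :=
    ((hy.absCont.fun_mul hq.absCont_deriv).fun_sub (hy.absCont_deriv.fun_mul hq.absCont)).mono
      (by rw [uIcc_of_le hαβ, uIcc_of_le (hα.trans (hαβ.trans hβ))]; exact Icc_subset_Icc hα hβ)
  rw [← hac.integral_deriv_eq_sub]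
  refine integral_congr_ae_Ioo hα hαβ hβ ?_
  filter_upwards [hy.hasDerivAt, hy.hasDerivAt_deriv, hq.hasDerivAt, hq.hasDerivAt_deriv]
    with x hyx hy₁x hqx hq₁x
  rw [((hyx.fun_mul hq₁x).fun_sub (hy₁x.fun_mul hqx)).deriv]
  ring

end HasSecondDeriv

namespace HasDirichletSecondDeriv

variable {y y₁ y₂ z z₁ z₂ : ℝ → ℝ}

theorem sub (hy : HasDirichletSecondDeriv L y y₁ y₂) (hz : HasDirichletSecondDeriv L z z₁ z₂) :
    HasDirichletSecondDeriv L (fun x => y x - z x) (fun x => y₁ x - z₁ x)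
      (fun x => y₂ x - z₂ x) where
  absCont := hy.absCont.fun_sub hz.absCont
  absCont_deriv := hy.absCont_deriv.fun_sub hz.absCont_deriv
  hasDerivAt := by
    filter_upwards [hy.hasDerivAt, hz.hasDerivAt] with x hyx hzx using hyx.fun_sub hzx
  hasDerivAt_deriv := by
    filter_upwards [hy.hasDerivAt_deriv, hz.hasDerivAt_deriv] with x hyx hzx using hyx.fun_sub hzx
  left_eq_zero := by rw [hy.left_eq_zero, hz.left_eq_zero, sub_zero]
  right_eq_zero := by rw [hy.right_eq_zero, hz.right_eq_zero, sub_zero]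

theorem integral_mul_deriv₂_comm (hL : 0 ≤ L) (hy : HasDirichletSecondDeriv L y y₁ y₂)
    (hz : HasDirichletSecondDeriv L z z₁ z₂) :
    ∫ x in (0 : ℝ)..L, y x * z₂ x = ∫ x in (0 : ℝ)..L, y₂ x * z x := by
  have hlagrange := hy.integral_mul_deriv₂_sub hz.toHasSecondDeriv le_rfl hL le_rfl
  rw [intervalIntegral.integral_sub
    ((hz.intervalIntegrable_deriv₂ hL).continuousOn_mul hy.absCont.continuousOn)
    ((hy.intervalIntegrable_deriv₂ hL).mul_continuousOn hz.absCont.continuousOn)] at hlagrange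
  simp only [hy.left_eq_zero, hy.right_eq_zero, hz.left_eq_zero, hz.right_eq_zero] at hlagrange
  linarith

theorem green_representation (hL : 0 ≤ L) {μ w : ℝ} {q q₁ r r₁ : ℝ → ℝ}
    (hy : HasDirichletSecondDeriv L y y₁ y₂)
    (hq : HasSecondDeriv L q q₁ (fun x => μ * q x)) (hr : HasSecondDeriv L r r₁ (fun x => μ * r x))
    (hq0 : q 0 = 0) (hrL : r L = 0) (hqc : Continuous q) (hrc : Continuous r)
    (hw : w ≠ 0) (hwronskian : ∀ x, q₁ x * r x - q x * r₁ x = w) {x : ℝ} (hx : x ∈ Icc 0 L) :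
    y x = ∫ s in (0 : ℝ)..L, q (min x s) * r (max x s) / w * (μ * y s - y₂ s) := by
  have hint : IntervalIntegrable (fun s => q (min x s) * r (max x s) / w * (μ * y s - y₂ s))
      volume 0 L :=
    ((hy.intervalIntegrable.const_mul μ).sub
      (hy.intervalIntegrable_deriv₂ hL)).continuousOn_mul (by fun_prop)
  have hx' : x ∈ uIcc 0 L := by rwa [uIcc_of_le hL]
  rw [← intervalIntegral.integral_add_adjacent_intervals
    (hint.mono_set (uIcc_subset_uIcc_left hx')) (hint.mono_set (uIcc_subset_uIcc_right hx'))]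
  have hleft : ∫ s in (0 : ℝ)..x, q (min x s) * r (max x s) / w * (μ * y s - y₂ s)
      = r x / w * ∫ s in (0 : ℝ)..x, (y s * (μ * q s) - y₂ s * q s) := by
    rw [← intervalIntegral.integral_const_mul]
    refine intervalIntegral.integral_congr fun s hs => ?_
    rw [uIcc_of_le hx.1] at hs
    simp only [min_eq_right hs.2, max_eq_left hs.2]
    ring
  have hright : ∫ s in x..L, q (min x s) * r (max x s) / w * (μ * y s - y₂ s)
      = q x / w * ∫ s in x..L, (y s * (μ * r s) - y₂ s * r s) := by
    rw [← intervalIntegral.integral_const_mul]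
    refine intervalIntegral.integral_congr fun s hs => ?_
    rw [uIcc_of_le hx.2] at hs
    simp only [min_eq_left hs.1, max_eq_right hs.1]
    ring
  rw [hleft, hright, hy.integral_mul_deriv₂_sub hq le_rfl hx.1 hx.2,
    hy.integral_mul_deriv₂_sub hr hx.1 hx.2 le_rfl, hy.left_eq_zero, hy.right_eq_zero, hq0, hrL]
  field_simp
  rw [← hwronskian x]
  ring

end HasDirichletSecondDeriv

/-- Green's function of `-y''` on `[0, L]` with Dirichlet conditions. -/
def dirichletKernel (L x s : ℝ) : ℝ := min x s * (L - max x s) / L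

theorem continuous_dirichletKernel (x : ℝ) : Continuous (dirichletKernel L x) := by
  unfold dirichletKernel; fun_prop

theorem dirichletKernel_nonneg {x s : ℝ} (hx : x ∈ Icc 0 L) (hs : s ∈ Icc 0 L) :
    0 ≤ dirichletKernel L x s :=
  div_nonneg (mul_nonneg (le_min hx.1 hs.1) (sub_nonneg.2 (max_le hx.2 hs.2))) (hx.1.trans hx.2)

theorem dirichletKernel_le (hL : 0 < L) {x s : ℝ} (hx : x ∈ Icc 0 L) (hs : s ∈ Icc 0 L) :
    dirichletKernel L x s ≤ L :=
  div_le_of_le_mul₀ hL.le hL.le <| mul_le_mul ((min_le_left _ _).trans hx.2)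
    (sub_le_self _ (hx.1.trans (le_max_left _ _))) (sub_nonneg.2 (max_le hx.2 hs.2)) hL.le

namespace HasDirichletSecondDeriv

variable {y y₁ y₂ z z₁ z₂ : ℝ → ℝ} {x : ℝ}

theorem eq_integral_dirichletKernel (hL : 0 < L) (hy : HasDirichletSecondDeriv L y y₁ y₂)
    (hx : x ∈ Icc 0 L) : y x = ∫ s in (0 : ℝ)..L, dirichletKernel L x s * (-y₂ s) := by
  have hq : HasSecondDeriv L (fun x : ℝ => x) (fun _ => 1) (fun x => 0 * x) :=
    .of_hasDerivAt hasDerivAt_id (fun x => by simpa using hasDerivAt_const x (1 : ℝ)) (by fun_prop)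
  have hr : HasSecondDeriv L (fun x : ℝ => L - x) (fun _ => -1) (fun x => 0 * (L - x)) :=
    .of_hasDerivAt (fun x => by simpa using (hasDerivAt_id x).const_sub L)
      (fun x => by simpa using hasDerivAt_const x (-1 : ℝ)) (by fun_prop)
  simpa [dirichletKernel] using hy.green_representation hL.le hq hr rfl (by simp) (by fun_prop)
    (by fun_prop) hL.ne' (fun x => by ring) hx

theorem le_of_deriv₂_ge (hL : 0 < L) (hy : HasDirichletSecondDeriv L y y₁ y₂)
    (hz : HasDirichletSecondDeriv L z z₁ z₂)
    (h : ∀ᵐ x ∂(volume.restrict (Ioo 0 L)), z₂ x ≤ y₂ x) (hx : x ∈ Icc 0 L) : y x ≤ z x := by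
  rw [hy.eq_integral_dirichletKernel hL hx, hz.eq_integral_dirichletKernel hL hx]
  refine integral_kernel_mono hL.le (continuous_dirichletKernel x).continuousOn
    (fun s hs => dirichletKernel_nonneg hx hs) (hy.intervalIntegrable_deriv₂ hL.le).neg
    (hz.intervalIntegrable_deriv₂ hL.le).neg ?_
  filter_upwards [h] with x hx using neg_le_neg hx

theorem pos_of_deriv₂_nonpos {s : ℝ} (hy : HasDirichletSecondDeriv L y y₁ y₂)
    (hcont : ContinuousOn y₂ (Icc 0 L)) (hnonpos : ∀ t ∈ Icc 0 L, y₂ t ≤ 0) (hs : s ∈ Ioo 0 L)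
    (hneg : y₂ s < 0) (hx : x ∈ Ioo 0 L) : 0 < y x := by
  have hL : 0 < L := hx.1.trans hx.2
  have hx' := Ioo_subset_Icc_self hx
  rw [hy.eq_integral_dirichletKernel hL hx']
  refine intervalIntegral.integral_pos hL
    ((continuous_dirichletKernel x).continuousOn.mul hcont.neg)
    (fun t ht => mul_nonneg (dirichletKernel_nonneg hx' (Ioc_subset_Icc_self ht))
      (neg_nonneg.2 (hnonpos t (Ioc_subset_Icc_self ht))))
    ⟨s, Ioo_subset_Icc_self hs, mul_pos ?_ (neg_pos.2 hneg)⟩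
  exact div_pos (mul_pos (lt_min hx.1 hs.1) (sub_pos.2 (max_lt hx.2 hs.2))) hL

theorem abs_le_mul_integral_abs_deriv₂ (hL : 0 < L) (hy : HasDirichletSecondDeriv L y y₁ y₂)
    (hx : x ∈ Icc 0 L) : |y x| ≤ L * ∫ s in (0 : ℝ)..L, |y₂ s| := by
  have hy₂ := hy.intervalIntegrable_deriv₂ hL.le
  rw [hy.eq_integral_dirichletKernel hL hx, ← intervalIntegral.integral_const_mul]
  refine (intervalIntegral.abs_integral_le_integral_abs hL.le).trans
    (intervalIntegral.integral_mono_on hL.le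
      (hy₂.neg.continuousOn_mul (continuous_dirichletKernel x).continuousOn).abs
      (hy₂.abs.const_mul L) fun s hs => ?_)
  rw [abs_mul, abs_neg, abs_of_nonneg (dirichletKernel_nonneg hx hs)]
  exact mul_le_mul_of_nonneg_right (dirichletKernel_le hL hx hs) (abs_nonneg _)

end HasDirichletSecondDeriv

/-! ### Derivatives on `[0, L]` -/

section Derivatives

variable {u v : ℝ → ℝ}

theorem D_zero (L : ℝ) (u : ℝ → ℝ) : D L 0 u = u := iteratedDerivWithin_zero

theorem D_succ (L : ℝ) (k : ℕ) (u : ℝ → ℝ) : D L (k + 1) u = derivWithin (D L k u) (Icc 0 L) :=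
  iteratedDerivWithin_succ

theorem D_congr (h : EqOn u v (Icc 0 L)) (k : ℕ) : EqOn (D L k u) (D L k v) (Icc 0 L) :=
  iteratedDerivWithin_congr h

theorem contDiffOn_D (hL : 0 < L) {n : ℕ} (hu : ContDiffOn ℝ n u (Icc 0 L)) :
    ∀ {k m : ℕ}, m + k ≤ n → ContDiffOn ℝ m (D L k u) (Icc 0 L)
  | 0, m, h => by
    rw [D_zero]
    exact hu.of_le (by exact_mod_cast h)
  | k + 1, m, h => by
    rw [D_succ]
    exact (contDiffOn_D hL hu (k := k) (m := m + 1) (by omega)).derivWithin (uniqueDiffOn_Icc hL)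
      (by norm_cast)

theorem continuousOn_D (hL : 0 < L) {n k : ℕ} (hu : ContDiffOn ℝ n u (Icc 0 L)) (hk : k ≤ n) :
    ContinuousOn (D L k u) (Icc 0 L) :=
  (contDiffOn_D hL hu (m := 0) (by omega)).continuousOn

theorem absolutelyContinuousOnInterval_D (hL : 0 < L) {n k : ℕ}
    (hu : ContDiffOn ℝ n u (Icc 0 L)) (hk : k < n) :
    AbsolutelyContinuousOnInterval (D L k u) 0 L := by
  refine ContDiffOn.absolutelyContinuousOnInterval ?_
  rw [uIcc_of_le hL.le]
  exact contDiffOn_D hL hu (m := 1) (by omega)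

theorem hasDerivAt_D_of_differentiableAt {k : ℕ} {x : ℝ} (hx : x ∈ Ioo 0 L)
    (h : DifferentiableAt ℝ (D L k u) x) : HasDerivAt (D L k u) (D L (k + 1) u x) x := by
  rw [D_succ, derivWithin_of_mem_nhds (Icc_mem_nhds hx.1 hx.2)]
  exact h.hasDerivAt

theorem hasDerivAt_D (hL : 0 < L) {n k : ℕ} (hu : ContDiffOn ℝ n u (Icc 0 L))
    (hk : k < n) {x : ℝ} (hx : x ∈ Ioo 0 L) : HasDerivAt (D L k u) (D L (k + 1) u x) x :=
  hasDerivAt_D_of_differentiableAt hx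
    (((contDiffOn_D hL hu (m := 1) (by omega)).differentiableOn one_ne_zero).differentiableAt
      (Icc_mem_nhds hx.1 hx.2))

theorem D_succ_eqOn (hL : 0 < L) {f f' : ℝ → ℝ} {k : ℕ} (h : EqOn (D L k u) f (Icc 0 L))
    (hf : ∀ x, HasDerivAt f (f' x) x) : EqOn (D L (k + 1) u) f' (Icc 0 L) := fun x hx => by
  rw [D_succ, derivWithin_congr h (h hx)]
  exact (hf x).hasDerivWithinAt.derivWithin (uniqueDiffOn_Icc hL x hx)

theorem hasSecondDeriv_of_contDiffOn (hL : 0 < L) (hu : ContDiffOn ℝ 2 u (Icc 0 L)) :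
    HasSecondDeriv L u (D L 1 u) (D L 2 u) := by
  have hu : ContDiffOn ℝ (2 : ℕ) u (Icc 0 L) := by exact_mod_cast hu
  refine ⟨?_, absolutelyContinuousOnInterval_D hL hu (by norm_num), ?_, ?_⟩
  · simpa only [D_zero] using absolutelyContinuousOnInterval_D hL hu (k := 0) (by norm_num)
  · filter_upwards [ae_restrict_mem measurableSet_Ioo] with x hx
    simpa only [D_zero] using hasDerivAt_D hL hu (k := 0) (by norm_num) hx
  · filter_upwards [ae_restrict_mem measurableSet_Ioo] with x hx
    exact hasDerivAt_D hL hu (k := 1) (by norm_num) hx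

namespace MemW41

theorem contDiffOn_two (hu : MemW41 L u) : ContDiffOn ℝ 2 u (Icc 0 L) :=
  hu.contDiffOn.of_le (by norm_num)

theorem hasDirichletSecondDeriv (hL : 0 < L) (hu : MemW41 L u) (hbc : NavierBC L u) :
    HasDirichletSecondDeriv L u (D L 1 u) (D L 2 u) :=
  ⟨hasSecondDeriv_of_contDiffOn hL hu.contDiffOn_two, hbc.1, hbc.2.1⟩

theorem hasDirichletSecondDeriv_D_two (hL : 0 < L) (hu : MemW41 L u) (hbc : NavierBC L u) :
    HasDirichletSecondDeriv L (D L 2 u) (D L 3 u) (D L 4 u) := by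
  have hu' : ContDiffOn ℝ (3 : ℕ) u (Icc 0 L) := by exact_mod_cast hu.contDiffOn
  refine ⟨⟨absolutelyContinuousOnInterval_D hL hu' (by norm_num), hu.absCont, ?_, ?_⟩,
    hbc.2.2.1, hbc.2.2.2⟩
  · filter_upwards [ae_restrict_mem measurableSet_Ioo] with x hx
    exact hasDerivAt_D hL hu' (by norm_num) hx
  · filter_upwards [ae_restrict_mem measurableSet_Ioo,
      ae_restrict_of_ae hu.absCont.ae_differentiableAt] with x hx hdiff
    rw [uIcc_of_le hL.le] at hdiff
    exact hasDerivAt_D_of_differentiableAt hx (hdiff (Ioo_subset_Icc_self hx))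

theorem intervalIntegrable_D_four (hL : 0 < L) (hu : MemW41 L u) (hbc : NavierBC L u) :
    IntervalIntegrable (D L 4 u) volume 0 L :=
  (hu.hasDirichletSecondDeriv_D_two hL hbc).intervalIntegrable_deriv₂ hL.le

end MemW41

theorem absolutelyContinuousOnInterval_congr {f g : ℝ → ℝ} {α β : ℝ}
    (hf : AbsolutelyContinuousOnInterval f α β) (h : EqOn f g (uIcc α β)) :
    AbsolutelyContinuousOnInterval g α β := by
  rw [absolutelyContinuousOnInterval_iff] at hf ⊢
  intro ε hε
  obtain ⟨δ, hδ, hlt⟩ := hf ε hε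
  refine ⟨δ, hδ, fun E hE hE' => (Finset.sum_congr rfl fun i hi => ?_).trans_lt (hlt E hE hE')⟩
  rw [h (hE.1 i hi).1, h (hE.1 i hi).2]

theorem memW41_of_hasDerivAt (hL : 0 < L) {u₁ u₂ u₃ u₄ : ℝ → ℝ}
    (h₀ : ∀ x, HasDerivAt u (u₁ x) x) (h₁ : ∀ x, HasDerivAt u₁ (u₂ x) x)
    (h₂ : ∀ x, HasDerivAt u₂ (u₃ x) x) (h₃ : Continuous u₃)
    (hac : AbsolutelyContinuousOnInterval u₃ 0 L)
    (h₄ : ∀ᵐ x ∂(volume.restrict (Ioo 0 L)), HasDerivAt u₃ (u₄ x) x) :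
    MemW41 L u ∧ EqOn (D L 2 u) u₂ (Icc 0 L) ∧
      ∀ᵐ x ∂(volume.restrict (Ioo 0 L)), D L 4 u x = u₄ x := by
  have hD₁ : EqOn (D L 1 u) u₁ (Icc 0 L) := D_succ_eqOn hL (by rw [D_zero]; exact eqOn_refl _ _) h₀
  have hD₂ : EqOn (D L 2 u) u₂ (Icc 0 L) := D_succ_eqOn hL hD₁ h₁
  have hD₃ : EqOn (D L 3 u) u₃ (Icc 0 L) := D_succ_eqOn hL hD₂ h₂
  have hu : ContDiff ℝ (3 : ℕ) u := contDiff_succ_of_hasDerivAt h₀ <|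
    contDiff_succ_of_hasDerivAt h₁ <| contDiff_succ_of_hasDerivAt h₂ (contDiff_zero.2 h₃)
  refine ⟨⟨by exact_mod_cast hu.contDiffOn, absolutelyContinuousOnInterval_congr hac ?_⟩, hD₂, ?_⟩
  · rw [uIcc_of_le hL.le]
    exact hD₃.symm
  · filter_upwards [h₄, ae_restrict_mem measurableSet_Ioo] with x hx hmem
    have hx' : HasDerivAt (D L 3 u) (u₄ x) x :=
      hx.congr_of_eventuallyEq (eventuallyEq_of_mem (Icc_mem_nhds hmem.1 hmem.2) hD₃)
    exact (hasDerivAt_D_of_differentiableAt hmem hx'.differentiableAt).unique hx'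

end Derivatives

/-! ### The linear problem `u'''' - m² u'' = h` -/

section LinearProblem

variable {m : ℝ}

theorem hasDerivAt_sinh_mul (m x : ℝ) :
    HasDerivAt (fun x => Real.sinh (m * x)) (m * Real.cosh (m * x)) x := by
  simpa [mul_comm] using ((hasDerivAt_id x).const_mul m).sinh

theorem hasDerivAt_cosh_mul (m x : ℝ) :
    HasDerivAt (fun x => Real.cosh (m * x)) (m * Real.sinh (m * x)) x := by
  simpa [mul_comm] using ((hasDerivAt_id x).const_mul m).cosh

theorem exists_dirichlet_solution (hL : 0 < L) (hm : 0 < m) {P : ℝ → ℝ} (hP : Continuous P)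
    (A : ℝ) :
    ∃ z z₁ : ℝ → ℝ, (∀ x, HasDerivAt z (z₁ x) x) ∧
      (∀ x, HasDerivAt z₁ (m ^ 2 * (z x - P x)) x) ∧ z 0 = 0 ∧ z L = A := by
  -- Variation of constants.
  set c : ℝ → ℝ := fun x => ∫ s in (0 : ℝ)..x, Real.cosh (m * s) * P s with hc
  set d : ℝ → ℝ := fun x => ∫ s in (0 : ℝ)..x, Real.sinh (m * s) * P s with hd
  have hc' : ∀ x, HasDerivAt c (Real.cosh (m * x) * P x) x := fun x =>
    (Continuous.integral_hasStrictDerivAt (by fun_prop) 0 x).hasDerivAt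
  have hd' : ∀ x, HasDerivAt d (Real.sinh (m * x) * P x) x := fun x =>
    (Continuous.integral_hasStrictDerivAt (by fun_prop) 0 x).hasDerivAt
  have hS : Real.sinh (m * L) ≠ 0 := (Real.sinh_pos_iff.2 (mul_pos hm hL)).ne'
  obtain ⟨C, hC⟩ : ∃ C, -m * (Real.sinh (m * L) * c L - Real.cosh (m * L) * d L)
      + C * Real.sinh (m * L) = A :=
    ⟨(A + m * (Real.sinh (m * L) * c L - Real.cosh (m * L) * d L)) / Real.sinh (m * L), by
      field_simp; ring⟩
  refine ⟨fun x => -m * (Real.sinh (m * x) * c x - Real.cosh (m * x) * d x)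
    + C * Real.sinh (m * x), fun x => -m ^ 2 * (Real.cosh (m * x) * c x - Real.sinh (m * x) * d x)
    + C * (m * Real.cosh (m * x)), fun x => ?_, fun x => ?_, by simp [hc, hd], hC⟩
  · refine (((((hasDerivAt_sinh_mul m x).fun_mul (hc' x)).fun_sub
      ((hasDerivAt_cosh_mul m x).fun_mul (hd' x))).const_mul (-m)).fun_add
      ((hasDerivAt_sinh_mul m x).const_mul C)).congr_deriv ?_
    ring
  · refine (((((hasDerivAt_cosh_mul m x).fun_mul (hc' x)).fun_sub
      ((hasDerivAt_sinh_mul m x).fun_mul (hd' x))).const_mul (-m ^ 2)).fun_add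
      (((hasDerivAt_cosh_mul m x).const_mul m).const_mul C)).congr_deriv ?_
    linear_combination (-m ^ 2 * P x) * Real.cosh_sq_sub_sinh_sq (m * x)

theorem exists_continuous_primitive (hL : 0 ≤ L) {h : ℝ → ℝ}
    (hh : IntervalIntegrable h volume 0 L) :
    ∃ H : ℝ → ℝ, Continuous H ∧ AbsolutelyContinuousOnInterval H 0 L ∧
      ∀ᵐ x ∂(volume.restrict (Ioo 0 L)), HasDerivAt H (h x) x := by
  have hk : Integrable ((Ioo 0 L).indicator h) volume :=
    (integrable_indicator_iff measurableSet_Ioo).2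
      ((intervalIntegrable_iff_integrableOn_Ioo_of_le hL).1 hh)
  refine ⟨fun x => ∫ s in (0 : ℝ)..x, (Ioo 0 L).indicator h s,
    intervalIntegral.continuous_primitive (fun _ _ => hk.intervalIntegrable) 0,
    hk.intervalIntegrable.absolutelyContinuousOnInterval_intervalIntegral (by simp), ?_⟩
  filter_upwards [ae_restrict_of_ae (LocallyIntegrable.ae_hasDerivAt_integral hk.locallyIntegrable),
    ae_restrict_mem measurableSet_Ioo] with x hx hmem
  simpa [hmem] using hx 0

theorem exists_D_four_sub_eq (hL : 0 < L) (hm : 0 < m) {h : ℝ → ℝ}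
    (hh : IntervalIntegrable h volume 0 L) :
    ∃ u, MemW41 L u ∧ NavierBC L u ∧
      ∀ᵐ x ∂(volume.restrict (Ioo 0 L)), D L 4 u x - m ^ 2 * D L 2 u x = h x := by
  obtain ⟨H, hHc, hHac, hH⟩ := exists_continuous_primitive hL.le hh
  set P : ℝ → ℝ := fun x => ∫ s in (0 : ℝ)..x, H s with hP
  have hP' : ∀ x, HasDerivAt P (H x) x := fun x => (hHc.integral_hasStrictDerivAt 0 x).hasDerivAt
  have hPc : Continuous P := continuous_iff_continuousAt.2 fun x => (hP' x).continuousAt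
  -- `P'' = h` and `z'' = m² (z - P)`, so `P - z` is the second derivative of the solution.
  obtain ⟨z, z₁, hz, hz₁, hz0, hzL⟩ := exists_dirichlet_solution hL hm hPc (P L)
  have hzc : Continuous z := continuous_iff_continuousAt.2 fun x => (hz x).continuousAt
  have hz₁c : Continuous z₁ := continuous_iff_continuousAt.2 fun x => (hz₁ x).continuousAt
  have hZ : HasSecondDeriv L z z₁ (fun x => m ^ 2 * (z x - P x)) :=
    .of_hasDerivAt hz hz₁ (by fun_prop)
  obtain ⟨hmem, hD₂, hD₄⟩ := memW41_of_hasDerivAt hL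
    (u := fun x => (x * (P L / L) - z x) / m ^ 2) (u₁ := fun x => (P L / L - z₁ x) / m ^ 2)
    (u₂ := fun x => P x - z x) (u₃ := fun x => H x - z₁ x)
    (u₄ := fun x => h x - m ^ 2 * (z x - P x))
    (fun x => by
      simpa using (((hasDerivAt_id x).mul_const (P L / L)).fun_sub (hz x)).div_const (m ^ 2))
    (fun x => (((hz₁ x).const_sub (P L / L)).div_const (m ^ 2)).congr_deriv (by field_simp; ring))
    (fun x => (hP' x).fun_sub (hz x)) (by fun_prop) (hHac.fun_sub hZ.absCont_deriv)
    (by filter_upwards [hH] with x hx using hx.fun_sub (hz₁ x))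
  refine ⟨_, hmem, ⟨by simp [hz0], ?_, ?_, ?_⟩, ?_⟩
  · simp only [hzL]
    field_simp
    ring
  · rw [hD₂ (left_mem_Icc.2 hL.le)]
    simp [hz0, hP]
  · rw [hD₂ (right_mem_Icc.2 hL.le)]
    simp [hzL]
  · filter_upwards [hD₄, ae_restrict_mem measurableSet_Ioo] with x hx hmem
    rw [hx, hD₂ (Ioo_subset_Icc_self hmem)]
    ring

end LinearProblem

/-! ### The operator `-y'' + m² y` with Dirichlet conditions -/

section Resolvent

variable {m x s : ℝ} {y y₁ y₂ : ℝ → ℝ}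

/-- Green's function of `-y'' + m² y` on `[0, L]` with Dirichlet conditions. -/
def resolventKernel (L m x s : ℝ) : ℝ :=
  Real.sinh (m * min x s) * Real.sinh (m * (L - max x s)) / (m * Real.sinh (m * L))

theorem continuous_resolventKernel (L m x : ℝ) : Continuous (resolventKernel L m x) := by
  unfold resolventKernel; fun_prop

theorem sinh_mul_sinh_nonneg (hm : 0 ≤ m) (hx : x ∈ Icc 0 L) (hs : s ∈ Icc 0 L) :
    0 ≤ Real.sinh (m * min x s) * Real.sinh (m * (L - max x s)) :=
  mul_nonneg (Real.sinh_nonneg_iff.2 (mul_nonneg hm (le_min hx.1 hs.1)))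
    (Real.sinh_nonneg_iff.2 (mul_nonneg hm (sub_nonneg.2 (max_le hx.2 hs.2))))

theorem resolventKernel_nonneg (hm : 0 ≤ m) (hx : x ∈ Icc 0 L) (hs : s ∈ Icc 0 L) :
    0 ≤ resolventKernel L m x s :=
  div_nonneg (sinh_mul_sinh_nonneg hm hx hs)
    (mul_nonneg hm (Real.sinh_nonneg_iff.2 (mul_nonneg hm (hx.1.trans hx.2))))

theorem hasSecondDeriv_sinh_sub (m x : ℝ) :
    HasSecondDeriv L (fun s => Real.sinh (m * (x - s))) (fun s => -m * Real.cosh (m * (x - s)))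
      (fun s => m ^ 2 * Real.sinh (m * (x - s))) := by
  have hlin : ∀ s, HasDerivAt (fun s => m * (x - s)) (-m) s := fun s => by
    simpa using ((hasDerivAt_id s).const_sub x).const_mul m
  exact .of_hasDerivAt (fun s => (hlin s).sinh.congr_deriv (by ring))
    (fun s => ((hlin s).cosh.const_mul (-m)).congr_deriv (by ring)) (by fun_prop)

namespace HasDirichletSecondDeriv

theorem eq_integral_resolventKernel (hL : 0 < L) (hm : 0 < m)
    (hy : HasDirichletSecondDeriv L y y₁ y₂) (hx : x ∈ Icc 0 L) :
    y x = ∫ s in (0 : ℝ)..L, resolventKernel L m x s * (m ^ 2 * y s - y₂ s) := by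
  have hq : HasSecondDeriv L (fun x => Real.sinh (m * x)) (fun x => m * Real.cosh (m * x))
      (fun x => m ^ 2 * Real.sinh (m * x)) :=
    .of_hasDerivAt (hasDerivAt_sinh_mul m)
      (fun x => ((hasDerivAt_cosh_mul m x).const_mul m).congr_deriv (by ring)) (by fun_prop)
  refine hy.green_representation hL.le hq (hasSecondDeriv_sinh_sub m L) (by simp) (by simp)
    (by fun_prop) (by fun_prop) (mul_pos hm (Real.sinh_pos_iff.2 (mul_pos hm hL))).ne'
    (fun x => ?_) hx
  rw [show m * L = m * x + m * (L - x) by ring, Real.sinh_add]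
  ring

theorem nonneg_of_deriv₂_le (hL : 0 < L) (hm : 0 < m) (hy : HasDirichletSecondDeriv L y y₁ y₂)
    (h : ∀ s ∈ Icc 0 L, y₂ s ≤ m ^ 2 * y s) (hx : x ∈ Icc 0 L) : 0 ≤ y x := by
  rw [hy.eq_integral_resolventKernel hL hm hx]
  exact intervalIntegral.integral_nonneg hL.le fun s hs =>
    mul_nonneg (resolventKernel_nonneg hm.le hx hs) (sub_nonneg.2 (h s hs))

theorem mul_le_deriv_mul_sinh (hm : 0 < m) (hy : HasDirichletSecondDeriv L y y₁ y₂)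
    (h : ∀ s ∈ Icc 0 L, y₂ s ≤ m ^ 2 * y s) (hx : x ∈ Icc 0 L) :
    m * y x ≤ y₁ 0 * Real.sinh (m * x) := by
  have hlagrange := hy.integral_mul_deriv₂_sub (hasSecondDeriv_sinh_sub m x) le_rfl hx.1 hx.2
  have hnonneg : 0 ≤ ∫ s in (0 : ℝ)..x,
      (y s * (m ^ 2 * Real.sinh (m * (x - s))) - y₂ s * Real.sinh (m * (x - s))) := by
    refine intervalIntegral.integral_nonneg hx.1 fun s hs => ?_
    have hsinh : 0 ≤ Real.sinh (m * (x - s)) :=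
      Real.sinh_nonneg_iff.2 (mul_nonneg hm.le (sub_nonneg.2 hs.2))
    have hmul := mul_le_mul_of_nonneg_right (h s ⟨hs.1, hs.2.trans hx.2⟩) hsinh
    linarith
  rw [hlagrange] at hnonneg
  simp only [sub_self, mul_zero, Real.cosh_zero, mul_one, mul_neg, Real.sinh_zero, sub_zero,
    hy.left_eq_zero, neg_mul, zero_mul, neg_zero, zero_sub, sub_neg_eq_add, le_neg_add_iff_add_le,
    add_zero] at hnonneg
  linarith

end HasDirichletSecondDeriv

/-- The parabola `x (L - x) / 2`, the solution of `-y'' = 1` with Dirichlet conditions. -/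
def arch (L x : ℝ) : ℝ := x * (L - x) / 2

/-- The solution of `-g'' + m² g = 1` with Dirichlet conditions on `[0, L]`. -/
def resolventOne (L m x : ℝ) : ℝ :=
  (1 - Real.cosh (m * (L / 2 - x)) / Real.cosh (m * (L / 2))) / m ^ 2

/-- The derivative of `resolventOne`. -/
def resolventOneDeriv (L m x : ℝ) : ℝ :=
  Real.sinh (m * (L / 2 - x)) / (m * Real.cosh (m * (L / 2)))

/-- The solution of `-ψ'' + m² ψ = x (L - x) / 2` with Dirichlet conditions on `[0, L]`. -/
def resolventArch (L m x : ℝ) : ℝ := (arch L x - resolventOne L m x) / m ^ 2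

/-- The derivative of `resolventArch`. -/
def resolventArchDeriv (L m x : ℝ) : ℝ := (L / 2 - x - resolventOneDeriv L m x) / m ^ 2

theorem arch_nonneg (hx : x ∈ Icc 0 L) : 0 ≤ arch L x :=
  div_nonneg (mul_nonneg hx.1 (sub_nonneg.2 hx.2)) zero_le_two

theorem continuous_arch (L : ℝ) : Continuous (arch L) := by unfold arch; fun_prop

theorem continuous_resolventOne (L m : ℝ) : Continuous (resolventOne L m) := by
  unfold resolventOne; fun_prop

theorem continuous_resolventArch (L m : ℝ) : Continuous (resolventArch L m) := by
  have := continuous_arch L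
  have := continuous_resolventOne L m
  unfold resolventArch; fun_prop

theorem resolventOne_sub_left (L m x : ℝ) : resolventOne L m (L - x) = resolventOne L m x := by
  unfold resolventOne
  rw [show m * (L / 2 - (L - x)) = -(m * (L / 2 - x)) by ring, Real.cosh_neg]

theorem resolventArch_sub_left (L m x : ℝ) : resolventArch L m (L - x) = resolventArch L m x := by
  unfold resolventArch arch
  rw [resolventOne_sub_left]
  ring

theorem hasDerivAt_arch (x : ℝ) : HasDerivAt (arch L) (L / 2 - x) x := by
  refine (((hasDerivAt_id x).fun_mul ((hasDerivAt_id x).const_sub L)).div_const 2).congr_deriv ?_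
  simp only [id]
  ring

theorem hasDerivAt_resolventOne (hm : m ≠ 0) (x : ℝ) :
    HasDerivAt (resolventOne L m) (resolventOneDeriv L m x) x := by
  have hlin : HasDerivAt (fun x => m * (L / 2 - x)) (-m) x := by
    simpa using ((hasDerivAt_id x).const_sub (L / 2)).const_mul m
  refine (((hlin.cosh.div_const _).const_sub 1).div_const _).congr_deriv ?_
  unfold resolventOneDeriv
  field_simp

theorem hasDerivAt_resolventOneDeriv (hm : m ≠ 0) (x : ℝ) :
    HasDerivAt (resolventOneDeriv L m) (m ^ 2 * resolventOne L m x - 1) x := by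
  have hlin : HasDerivAt (fun x => m * (L / 2 - x)) (-m) x := by
    simpa using ((hasDerivAt_id x).const_sub (L / 2)).const_mul m
  refine (hlin.sinh.div_const _).congr_deriv ?_
  unfold resolventOne
  field_simp
  ring

theorem hasDerivAt_resolventArchDeriv (hm : m ≠ 0) (x : ℝ) :
    HasDerivAt (resolventArchDeriv L m) (m ^ 2 * resolventArch L m x - arch L x) x := by
  refine ((((hasDerivAt_id x).const_sub (L / 2)).fun_sub
    (hasDerivAt_resolventOneDeriv hm x)).div_const (m ^ 2)).congr_deriv ?_
  unfold resolventArch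
  field_simp
  ring

theorem hasDirichletSecondDeriv_arch :
    HasDirichletSecondDeriv L (arch L) (fun x => L / 2 - x) (fun _ => -1) :=
  ⟨.of_hasDerivAt hasDerivAt_arch (fun x => (hasDerivAt_id x).const_sub (L / 2)) (by fun_prop),
    by simp [arch], by simp [arch]⟩

theorem HasDirichletSecondDeriv.integral_arch_mul_deriv₂ {y y₁ y₂ : ℝ → ℝ} (hL : 0 ≤ L)
    (hy : HasDirichletSecondDeriv L y y₁ y₂) :
    ∫ s in (0 : ℝ)..L, arch L s * y₂ s = -∫ s in (0 : ℝ)..L, y s := by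
  rw [hasDirichletSecondDeriv_arch.integral_mul_deriv₂_comm hL hy,
    intervalIntegral.integral_const_mul, neg_one_mul]

theorem hasDirichletSecondDeriv_resolventOne (hm : m ≠ 0) :
    HasDirichletSecondDeriv L (resolventOne L m) (resolventOneDeriv L m)
      (fun x => m ^ 2 * resolventOne L m x - 1) := by
  have hzero : resolventOne L m 0 = 0 := by simp [resolventOne, (Real.cosh_pos _).ne']
  refine ⟨.of_hasDerivAt (hasDerivAt_resolventOne hm) (hasDerivAt_resolventOneDeriv hm) ?_,
    hzero, by rw [← resolventOne_sub_left, sub_self, hzero]⟩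
  exact ((continuous_resolventOne L m).const_mul _).sub continuous_const

theorem hasDirichletSecondDeriv_resolventArch (hm : m ≠ 0) :
    HasDirichletSecondDeriv L (resolventArch L m) (resolventArchDeriv L m)
      (fun x => m ^ 2 * resolventArch L m x - arch L x) := by
  have hzero : resolventArch L m 0 = 0 := by
    simp [resolventArch, arch, (hasDirichletSecondDeriv_resolventOne (L := L) hm).left_eq_zero]
  refine ⟨.of_hasDerivAt (fun x => ?_) (hasDerivAt_resolventArchDeriv hm) ?_,
    hzero, by rw [← resolventArch_sub_left, sub_self, hzero]⟩
  · exact ((hasDerivAt_arch x).fun_sub (hasDerivAt_resolventOne hm x)).div_const (m ^ 2)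
  · exact ((continuous_resolventArch L m).const_mul _).sub (continuous_arch L)

theorem resolventOne_nonneg (hL : 0 < L) (hm : 0 < m) (hx : x ∈ Icc 0 L) :
    0 ≤ resolventOne L m x :=
  (hasDirichletSecondDeriv_resolventOne hm.ne').nonneg_of_deriv₂_le hL hm
    (fun _ _ => sub_le_self _ zero_le_one) hx

theorem resolventArch_nonneg (hL : 0 < L) (hm : 0 < m) (hx : x ∈ Icc 0 L) :
    0 ≤ resolventArch L m x :=
  (hasDirichletSecondDeriv_resolventArch hm.ne').nonneg_of_deriv₂_le hL hm
    (fun _ hs => sub_le_self _ (arch_nonneg hs)) hx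

theorem mul_resolventOne_le (hm : 0 < m) (hx : x ∈ Icc 0 L) :
    m * resolventOne L m x ≤ resolventOneDeriv L m 0 * Real.sinh (m * x) :=
  (hasDirichletSecondDeriv_resolventOne hm.ne').mul_le_deriv_mul_sinh hm
    (fun _ _ => sub_le_self _ zero_le_one) hx

theorem mul_resolventArch_le (hm : 0 < m) (hx : x ∈ Icc 0 L) :
    m * resolventArch L m x ≤ resolventArchDeriv L m 0 * Real.sinh (m * x) :=
  (hasDirichletSecondDeriv_resolventArch hm.ne').mul_le_deriv_mul_sinh hm
    (fun _ hs => sub_le_self _ (arch_nonneg hs)) hx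

theorem resolventOne_mul_resolventArch_le (hL : 0 < L) (hm : 0 < m) (hx : x ∈ Icc 0 L)
    (hs : s ∈ Icc 0 L) :
    m * resolventOne L m x * (m * resolventArch L m s)
      ≤ resolventOneDeriv L m 0 * resolventArchDeriv L m 0
        * (Real.sinh (m * min x s) * Real.sinh (m * (L - max x s))) := by
  have reflect : ∀ {r}, r ∈ Icc 0 L → L - r ∈ Icc 0 L := fun hr =>
    ⟨sub_nonneg.2 hr.2, sub_le_self _ hr.1⟩
  have hg : 0 ≤ m * resolventOne L m x := mul_nonneg hm.le (resolventOne_nonneg hL hm hx)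
  have hψ : 0 ≤ m * resolventArch L m s := mul_nonneg hm.le (resolventArch_nonneg hL hm hs)
  rcases le_total x s with hxs | hsx
  · have hgx := mul_resolventOne_le hm hx
    have hψs := mul_resolventArch_le hm (reflect hs)
    rw [resolventArch_sub_left] at hψs
    rw [min_eq_left hxs, max_eq_right hxs, mul_mul_mul_comm (resolventOneDeriv L m 0)]
    exact mul_le_mul hgx hψs hψ (hg.trans hgx)
  · have hgx := mul_resolventOne_le hm (reflect hx)
    have hψs := mul_resolventArch_le hm hs
    rw [resolventOne_sub_left] at hgx
    rw [min_eq_right hsx, max_eq_left hsx, mul_comm (Real.sinh (m * s)),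
      mul_mul_mul_comm (resolventOneDeriv L m 0)]
    exact mul_le_mul hgx hψs hψ (hg.trans hgx)

theorem integral_resolventKernel (hL : 0 < L) (hm : 0 < m) (hx : x ∈ Icc 0 L) :
    ∫ s in (0 : ℝ)..L, resolventKernel L m x s = resolventOne L m x := by
  rw [(hasDirichletSecondDeriv_resolventOne hm.ne').eq_integral_resolventKernel hL hm hx]
  simp only [sub_sub_cancel, mul_one]

theorem integral_resolventArch_nonneg (hL : 0 < L) (hm : 0 < m) :
    0 ≤ ∫ s in (0 : ℝ)..L, resolventArch L m s :=
  intervalIntegral.integral_nonneg hL.le fun _ hs => resolventArch_nonneg hL hm hs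

theorem integral_resolventArch (hm : m ≠ 0) :
    ∫ s in (0 : ℝ)..L, resolventArch L m s
      = (L ^ 3 / 12 - 2 * resolventArchDeriv L m 0) / m ^ 2 := by
  have hprimitive : ∀ x, HasDerivAt
      (fun x => (resolventArchDeriv L m x + (L * x ^ 2 / 4 - x ^ 3 / 6)) / m ^ 2)
      (resolventArch L m x) x := fun x => by
    refine (((hasDerivAt_resolventArchDeriv hm x).fun_add ((((hasDerivAt_pow 2 x).const_mul
      L).div_const 4).fun_sub ((hasDerivAt_pow 3 x).div_const 6))).div_const _).congr_deriv ?_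
    unfold arch
    field_simp
    push_cast
    ring
  have hreflect : resolventArchDeriv L m L = -resolventArchDeriv L m 0 := by
    unfold resolventArchDeriv resolventOneDeriv
    rw [show m * (L / 2 - L) = -(m * (L / 2 - 0)) by ring, Real.sinh_neg]
    ring
  rw [intervalIntegral.integral_eq_sub_of_hasDerivAt (fun x _ => hprimitive x)
    ((continuous_resolventArch L m).intervalIntegrable _ _), hreflect]
  ring

end Resolvent

/-! ### The operator `u'''' - M u'' + N ∫ u` with Navier conditions -/

section NonlocalOperator

variable {m M N x s : ℝ} {u v : ℝ → ℝ}

/-- The nonlocal operator `u'''' - M u'' + N ∫ u`, the left-hand side of both the Melan problem and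
its iteration. -/
def nonlocalOp (L M N : ℝ) (u : ℝ → ℝ) (x : ℝ) : ℝ :=
  D L 4 u x - M * D L 2 u x + N * ∫ t in (0 : ℝ)..L, u t

/-- The kernel that recovers `-u''` from `u'''' - m² u'' + N ∫ u`: Green's function of
`-y'' + m² y`, perturbed by a rank-one term. -/
def nonlocalKernel (L m N x s : ℝ) : ℝ :=
  resolventKernel L m x s
    - N * resolventOne L m x / (1 + N * ∫ t in (0 : ℝ)..L, resolventArch L m t) *
      resolventArch L m s

theorem continuous_nonlocalKernel (L m N x : ℝ) : Continuous (nonlocalKernel L m N x) :=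
  (continuous_resolventKernel L m x).sub ((continuous_resolventArch L m).const_mul _)

theorem one_add_mul_integral_resolventArch_pos (hL : 0 < L) (hm : 0 < m) (hN : 0 ≤ N) :
    0 < 1 + N * ∫ t in (0 : ℝ)..L, resolventArch L m t :=
  add_pos_of_pos_of_nonneg one_pos (mul_nonneg hN (integral_resolventArch_nonneg hL hm))

theorem MemW41.intervalIntegrable_nonlocalOp (hL : 0 < L) (hu : MemW41 L u) (hbc : NavierBC L u)
    (M N : ℝ) : IntervalIntegrable (nonlocalOp L M N u) volume 0 L :=
  ((hu.intervalIntegrable_D_four hL hbc).sub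
    ((hu.hasDirichletSecondDeriv_D_two hL hbc).intervalIntegrable.const_mul M)).add
      intervalIntegrable_const

theorem MemW41.integral_resolventArch_mul_nonlocalOp (hL : 0 < L) (hm : m ≠ 0) (hu : MemW41 L u)
    (hbc : NavierBC L u) (N : ℝ) :
    ∫ s in (0 : ℝ)..L, resolventArch L m s * nonlocalOp L (m ^ 2) N u s
      = (1 + N * ∫ s in (0 : ℝ)..L, resolventArch L m s) * ∫ s in (0 : ℝ)..L, u s := by
  have hD₂ := hu.hasDirichletSecondDeriv_D_two hL hbc
  have hψ := hasDirichletSecondDeriv_resolventArch (L := L) hm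
  have harch := (hu.hasDirichletSecondDeriv hL hbc).integral_arch_mul_deriv₂ hL.le
  have hselfadjoint := hD₂.integral_mul_deriv₂_comm hL.le hψ
  set I := ∫ s in (0 : ℝ)..L, u s with hI
  calc ∫ s in (0 : ℝ)..L, resolventArch L m s * nonlocalOp L (m ^ 2) N u s
      = ∫ s in (0 : ℝ)..L, (D L 4 u s * resolventArch L m s
          - D L 2 u s * (m ^ 2 * resolventArch L m s - arch L s) - arch L s * D L 2 u s
          + N * I * resolventArch L m s) := by
        refine intervalIntegral.integral_congr fun s _ => ?_
        simp only [nonlocalOp, ← hI]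
        ring
    _ = _ := by
        have hint₄ := (hD₂.intervalIntegrable_deriv₂ hL.le).mul_continuousOn hψ.absCont.continuousOn
        have hint₂ : IntervalIntegrable
            (fun s => D L 2 u s * (m ^ 2 * resolventArch L m s - arch L s)) volume 0 L :=
          hD₂.intervalIntegrable.mul_continuousOn (((continuous_resolventArch L m).const_mul
            (m ^ 2)).sub (continuous_arch L)).continuousOn
        have hint_arch := hD₂.intervalIntegrable.continuousOn_mul (continuous_arch L).continuousOn
        rw [intervalIntegral.integral_add ((hint₄.sub hint₂).sub hint_arch)
            (hψ.intervalIntegrable.const_mul _),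
          intervalIntegral.integral_sub (hint₄.sub hint₂) hint_arch,
          intervalIntegral.integral_sub hint₄ hint₂, intervalIntegral.integral_const_mul,
          hselfadjoint, harch]
        ring

theorem MemW41.integral_resolventKernel_mul_nonlocalOp (hL : 0 < L) (hm : 0 < m)
    (hu : MemW41 L u) (hbc : NavierBC L u) (N : ℝ) (hx : x ∈ Icc 0 L) :
    ∫ s in (0 : ℝ)..L, resolventKernel L m x s * nonlocalOp L (m ^ 2) N u s
      = -D L 2 u x + N * resolventOne L m x * ∫ s in (0 : ℝ)..L, u s := by
  have hD₂ := hu.hasDirichletSecondDeriv_D_two hL hbc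
  have hint : IntervalIntegrable
      (fun s => -(resolventKernel L m x s * (m ^ 2 * D L 2 u s - D L 4 u s))) volume 0 L :=
    (((hD₂.intervalIntegrable.const_mul _).sub
      (hD₂.intervalIntegrable_deriv₂ hL.le)).continuousOn_mul
        (continuous_resolventKernel L m x).continuousOn).neg
  rw [hD₂.eq_integral_resolventKernel hL hm hx, ← integral_resolventKernel hL hm hx, mul_right_comm,
    ← intervalIntegral.integral_const_mul, ← intervalIntegral.integral_neg,
    ← intervalIntegral.integral_add hint
      (((continuous_resolventKernel L m x).intervalIntegrable _ _).const_mul _)]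
  refine intervalIntegral.integral_congr fun s _ => ?_
  simp only [nonlocalOp]
  ring

theorem MemW41.neg_D_two_eq_integral (hL : 0 < L) (hm : 0 < m) (hN : 0 ≤ N) (hu : MemW41 L u)
    (hbc : NavierBC L u) (hx : x ∈ Icc 0 L) :
    -D L 2 u x = ∫ s in (0 : ℝ)..L, nonlocalKernel L m N x s * nonlocalOp L (m ^ 2) N u s := by
  have hpos := one_add_mul_integral_resolventArch_pos hL hm hN
  have hop := hu.intervalIntegrable_nonlocalOp hL hbc (m ^ 2) N
  simp only [nonlocalKernel, sub_mul, mul_assoc _ (resolventArch L m _)]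
  rw [intervalIntegral.integral_sub
      (hop.continuousOn_mul (continuous_resolventKernel L m x).continuousOn)
      ((hop.continuousOn_mul (continuous_resolventArch L m).continuousOn).const_mul _),
    intervalIntegral.integral_const_mul, hu.integral_resolventKernel_mul_nonlocalOp hL hm hbc N hx,
    hu.integral_resolventArch_mul_nonlocalOp hL hm.ne' hbc N]
  field_simp
  ring

theorem exists_nonlocalOp_eq (hL : 0 < L) (hM : 0 < M) (hN : 0 ≤ N) {f : ℝ → ℝ}
    (hf : IntervalIntegrable f volume 0 L) :
    ∃ u, MemW41 L u ∧ NavierBC L u ∧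
      ∀ᵐ x ∂(volume.restrict (Ioo 0 L)), nonlocalOp L M N u x = f x := by
  obtain ⟨m, hm, rfl⟩ : ∃ m, 0 < m ∧ m ^ 2 = M := ⟨√M, Real.sqrt_pos.2 hM, Real.sq_sqrt hM.le⟩
  have hpos := one_add_mul_integral_resolventArch_pos hL hm hN
  have hψ := continuous_resolventArch L m
  -- The value that the nonlocal term of the solution must take.
  set J := (∫ s in (0 : ℝ)..L, resolventArch L m s * f s) /
    (1 + N * ∫ t in (0 : ℝ)..L, resolventArch L m t) with hJ
  obtain ⟨u, hu, hbc, heq⟩ := exists_D_four_sub_eq hL hm (h := fun x => f x - N * J)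
    (hf.sub intervalIntegrable_const)
  have hint : ∫ t in (0 : ℝ)..L, u t = J := by
    have hmoment := hu.integral_resolventArch_mul_nonlocalOp hL hm.ne' hbc 0
    rw [zero_mul, add_zero, one_mul] at hmoment
    have hcongr : ∫ s in (0 : ℝ)..L, resolventArch L m s * nonlocalOp L (m ^ 2) 0 u s
        = ∫ s in (0 : ℝ)..L, (resolventArch L m s * f s - N * J * resolventArch L m s) := by
      refine integral_congr_ae_Ioo le_rfl hL.le le_rfl ?_
      filter_upwards [heq] with x hx
      rw [nonlocalOp, zero_mul, add_zero, hx]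
      ring
    rw [← hmoment, hcongr, intervalIntegral.integral_sub (hf.continuousOn_mul hψ.continuousOn)
      ((hψ.intervalIntegrable _ _).const_mul _), intervalIntegral.integral_const_mul,
      ← div_mul_cancel₀ (∫ s in (0 : ℝ)..L, resolventArch L m s * f s) hpos.ne', ← hJ]
    ring
  refine ⟨u, hu, hbc, ?_⟩
  filter_upwards [heq] with x hx
  rw [nonlocalOp, hint, hx]
  ring

theorem mul_le_of_le_sigma (hL : 0 < L) (hm : 0 < m) (hN : 0 ≤ N)
    (hkey : N ≤ 4 * m ^ 2 / L ^ 3 * sigma (m * L)) :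
    N * (6 * (m * L) * Real.cosh (m * L) + 6 * (m * L) - 12 * Real.sinh (m * L) - (m * L) ^ 3)
      ≤ 12 * m ^ 5 := by
  unfold sigma at hkey
  set Q := 6 * (m * L) * Real.cosh (m * L) + 6 * (m * L) - 12 * Real.sinh (m * L) - (m * L) ^ 3
  rcases le_or_gt Q 0 with hQ | hQ
  · exact (mul_nonpos_of_nonneg_of_nonpos hN hQ).trans (by positivity)
  · rw [← le_div_iff₀ hQ]
    refine hkey.trans_eq ?_
    field_simp
    ring

theorem mul_sinh_mul_deriv_le (hL : 0 < L) (hm : 0 < m) (hN : 0 ≤ N)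
    (hkey : N ≤ 4 * m ^ 2 / L ^ 3 * sigma (m * L)) :
    N * Real.sinh (m * L) * (resolventOneDeriv L m 0 * resolventArchDeriv L m 0)
      ≤ m * (1 + N * ∫ s in (0 : ℝ)..L, resolventArch L m s) := by
  have hbound := mul_le_of_le_sigma hL hm hN hkey
  have hdouble : m * L = 2 * (m * (L / 2)) := by ring
  have hc := Real.cosh_pos (m * (L / 2))
  have hsq := Real.cosh_sq (m * (L / 2))
  rw [hdouble, Real.sinh_two_mul, Real.cosh_two_mul, ← hdouble, hsq] at hbound
  rw [← sub_nonneg, integral_resolventArch hm.ne', hdouble, Real.sinh_two_mul]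
  unfold resolventArchDeriv resolventOneDeriv
  rw [sub_zero]
  set σ := Real.sinh (m * (L / 2))
  set γ := Real.cosh (m * (L / 2))
  have hdiff : m * (1 + N * ((L ^ 3 / 12 - 2 * ((L / 2 - σ / (m * γ)) / m ^ 2)) / m ^ 2))
      - N * (2 * σ * γ) * (σ / (m * γ) * ((L / 2 - σ / (m * γ)) / m ^ 2))
      = (12 * m ^ 5 - N * (6 * (m * L) * (σ ^ 2 + 1 + σ ^ 2) + 6 * (m * L) - 12 * (2 * σ * γ)
          - (m * L) ^ 3)) / (12 * m ^ 4) := by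
    field_simp
    linear_combination -(24 * N * σ) * hsq
  rw [hdiff]
  exact div_nonneg (sub_nonneg.2 hbound) (by positivity)

theorem nonlocalKernel_nonneg (hL : 0 < L) (hm : 0 < m) (hN : 0 ≤ N)
    (hkey : N ≤ 4 * m ^ 2 / L ^ 3 * sigma (m * L)) (hx : x ∈ Icc 0 L) (hs : s ∈ Icc 0 L) :
    0 ≤ nonlocalKernel L m N x s := by
  have hE := one_add_mul_integral_resolventArch_pos hL hm hN
  have hsinh : 0 < Real.sinh (m * L) := Real.sinh_pos_iff.2 (mul_pos hm hL)
  have hprod := mul_le_mul_of_nonneg_left (resolventOne_mul_resolventArch_le hL hm hx hs) hN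
  have hconst := mul_le_mul_of_nonneg_right (mul_sinh_mul_deriv_le hL hm hN hkey)
    (sinh_mul_sinh_nonneg hm.le hx hs)
  unfold nonlocalKernel resolventKernel
  rw [div_mul_eq_mul_div, sub_nonneg, div_le_div_iff₀ hE (mul_pos hm hsinh)]
  refine le_of_mul_le_mul_left ?_ hm
  linear_combination Real.sinh (m * L) * hprod + hconst

end NonlocalOperator

/-! ### The order of the sector and the comparison principle -/

section Order

variable {M N : ℝ} {u v α β : ℝ → ℝ}

/-- The order in which `u` lies below `v` when `u ≤ v` and `u'' ≥ v''` on `[0, L]`; a sector is an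
interval for it. -/
def Below (L : ℝ) (u v : ℝ → ℝ) : Prop :=
  ∀ x ∈ Icc 0 L, u x ≤ v x ∧ D L 2 v x ≤ D L 2 u x

theorem mem_sector_iff :
    u ∈ Sector L α β ↔ ContDiffOn ℝ 2 u (Icc 0 L) ∧ Below L α u ∧ Below L u β :=
  ⟨fun h => ⟨h.1, fun x hx => ⟨(h.2 x hx).1.1, (h.2 x hx).2.1⟩,
    fun x hx => ⟨(h.2 x hx).1.2, (h.2 x hx).2.2⟩⟩,
  fun h => ⟨h.1, fun x hx => ⟨⟨(h.2.1 x hx).1, (h.2.2 x hx).1⟩, (h.2.1 x hx).2, (h.2.2 x hx).2⟩⟩⟩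

namespace Below

theorem refl (L : ℝ) (u : ℝ → ℝ) : Below L u u := fun _ _ => ⟨le_rfl, le_rfl⟩

theorem eqOn (huv : Below L u v) (hvu : Below L v u) : EqOn u v (Icc 0 L) := fun x hx =>
  le_antisymm (huv x hx).1 (hvu x hx).1

theorem integral_le (hL : 0 ≤ L) (h : Below L u v) (hu : IntervalIntegrable u volume 0 L)
    (hv : IntervalIntegrable v volume 0 L) :
    ∫ t in (0 : ℝ)..L, u t ≤ ∫ t in (0 : ℝ)..L, v t :=
  intervalIntegral.integral_mono_on hL hu hv fun x hx => (h x hx).1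

theorem of_D_two_le (hL : 0 < L) (hu : HasDirichletSecondDeriv L u (D L 1 u) (D L 2 u))
    (hv : HasDirichletSecondDeriv L v (D L 1 v) (D L 2 v))
    (h : ∀ x ∈ Icc 0 L, D L 2 v x ≤ D L 2 u x) : Below L u v := fun x hx =>
  ⟨hu.le_of_deriv₂_ge hL hv
    (ae_restrict_of_forall_mem measurableSet_Ioo fun x hx => h x (Ioo_subset_Icc_self hx)) hx,
    h x hx⟩

theorem of_nonlocalOp_le (hL : 0 < L) (hM : 0 < M) (hN : 0 ≤ N)
    (hkey : N ≤ 4 * M / L ^ 3 * sigma (√M * L)) (hu : MemW41 L u) (hv : MemW41 L v)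
    (hub : NavierBC L u) (hvb : NavierBC L v)
    (h : ∀ᵐ x ∂(volume.restrict (Ioo 0 L)), nonlocalOp L M N u x ≤ nonlocalOp L M N v x) :
    Below L u v := by
  obtain ⟨m, hm, rfl⟩ : ∃ m, 0 < m ∧ m ^ 2 = M := ⟨√M, Real.sqrt_pos.2 hM, Real.sq_sqrt hM.le⟩
  rw [Real.sqrt_sq hm.le] at hkey
  refine of_D_two_le hL (hu.hasDirichletSecondDeriv hL hub) (hv.hasDirichletSecondDeriv hL hvb)
    fun x hx => ?_
  rw [← neg_le_neg_iff, hu.neg_D_two_eq_integral hL hm hN hub hx,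
    hv.neg_D_two_eq_integral hL hm hN hvb hx]
  exact integral_kernel_mono hL.le (continuous_nonlocalKernel L m N x).continuousOn
    (fun s hs => nonlocalKernel_nonneg hL hm hN hkey hx hs)
    (hu.intervalIntegrable_nonlocalOp hL hub _ _) (hv.intervalIntegrable_nonlocalOp hL hvb _ _) h

end Below

end Order

/-! ### The sector `[0, β]` -/

section Sector

variable {lam x : ℝ} {u : ℝ → ℝ}

theorem D_zero_right (L : ℝ) (k : ℕ) : D L k 0 = 0 := funext fun _ => iteratedDerivWithin_const_zero

theorem sineArc_regularity (hL : 0 < L) (lam : ℝ) :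
    MemW41 L (sineArc L lam) ∧
      EqOn (D L 2 (sineArc L lam))
        (fun x => -(lam * (Real.pi / L) ^ 2) * Real.sin (Real.pi / L * x)) (Icc 0 L) ∧
      ∀ᵐ x ∂(volume.restrict (Ioo 0 L)),
        D L 4 (sineArc L lam) x = lam * (Real.pi / L) ^ 4 * Real.sin (Real.pi / L * x) := by
  set κ := Real.pi / L
  have hlin : ∀ x, HasDerivAt (fun x => κ * x) κ x := fun x => by
    simpa using (hasDerivAt_id x).const_mul κ
  have hsin : ∀ {A B : ℝ} (x : ℝ), A * κ = B →
      HasDerivAt (fun x => A * Real.sin (κ * x)) (B * Real.cos (κ * x)) x :=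
    fun x h => ((hlin x).sin.const_mul _).congr_deriv (by rw [← h]; ring)
  have hcos : ∀ {A B : ℝ} (x : ℝ), -(A * κ) = B →
      HasDerivAt (fun x => A * Real.cos (κ * x)) (B * Real.sin (κ * x)) x :=
    fun x h => ((hlin x).cos.const_mul _).congr_deriv (by rw [← h]; ring)
  have h₃ : HasSecondDeriv L (fun x => -(lam * κ ^ 3) * Real.cos (κ * x)) _ _ :=
    .of_hasDerivAt (fun x => hcos (B := lam * κ ^ 4) x (by ring)) (fun x => hsin x rfl)
      (by fun_prop)
  exact memW41_of_hasDerivAt hL (fun x => hsin x rfl) (fun x => hcos x (by ring))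
    (fun x => hsin x (by ring)) (by fun_prop) h₃.absCont
    (Eventually.of_forall fun x => hcos x (by ring))

theorem memW41_sineArc (hL : 0 < L) (lam : ℝ) : MemW41 L (sineArc L lam) :=
  (sineArc_regularity hL lam).1

/-- The maximum of `-β''` over `[0, L]`. -/
def sineArcCurvature (L lam : ℝ) : ℝ := lam * (Real.pi ^ 2 / L ^ 2)

theorem sineArcCurvature_nonneg (hlam : 0 ≤ lam) : 0 ≤ sineArcCurvature L lam := by
  unfold sineArcCurvature; positivity

theorem D_two_sineArc (hL : 0 < L) (lam : ℝ) (hx : x ∈ Icc 0 L) :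
    D L 2 (sineArc L lam) x = -(sineArcCurvature L lam * Real.sin (Real.pi / L * x)) := by
  simpa only [sineArcCurvature, div_pow, neg_mul] using (sineArc_regularity hL lam).2.1 hx

theorem D_four_sineArc (hL : 0 < L) (lam : ℝ) : ∀ᵐ x ∂(volume.restrict (Ioo 0 L)),
    D L 4 (sineArc L lam) x = lam * (Real.pi ^ 4 / L ^ 4) * Real.sin (Real.pi / L * x) := by
  simpa only [div_pow] using (sineArc_regularity hL lam).2.2

theorem sineArc_left (L lam : ℝ) : sineArc L lam 0 = 0 := by simp [sineArc]

theorem sineArc_right (hL : L ≠ 0) (lam : ℝ) : sineArc L lam L = 0 := by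
  simp [sineArc, div_mul_cancel₀ _ hL]

theorem navierBC_sineArc (hL : 0 < L) (lam : ℝ) : NavierBC L (sineArc L lam) := by
  refine ⟨sineArc_left L lam, sineArc_right hL.ne' lam, ?_, ?_⟩
  · simp [D_two_sineArc hL lam (left_mem_Icc.2 hL.le)]
  · simp [D_two_sineArc hL lam (right_mem_Icc.2 hL.le), div_mul_cancel₀ _ hL.ne']

/-- The integral of `β` over `[0, L]`. -/
def sineArcIntegral (L lam : ℝ) : ℝ := 2 * lam * (L / Real.pi)

theorem integral_sineArc (hL : L ≠ 0) (lam : ℝ) :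
    ∫ t in (0 : ℝ)..L, sineArc L lam t = sineArcIntegral L lam := by
  simp only [sineArc]
  rw [intervalIntegral.integral_const_mul,
    intervalIntegral.integral_comp_mul_left Real.sin (div_ne_zero Real.pi_ne_zero hL),
    integral_sin, div_mul_cancel₀ _ hL]
  simp only [sineArcIntegral, inv_div, mul_zero, Real.cos_zero, Real.cos_pi, smul_eq_mul]
  ring

theorem sin_pi_div_mul_nonneg (hx : x ∈ Icc 0 L) : 0 ≤ Real.sin (Real.pi / L * x) := by
  rw [div_mul_eq_mul_div, mul_div_assoc]
  have hL : 0 ≤ L := hx.1.trans hx.2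
  exact Real.sin_nonneg_of_nonneg_of_le_pi (mul_nonneg Real.pi_nonneg (div_nonneg hx.1 hL))
    (mul_le_of_le_one_right Real.pi_nonneg (div_le_one_of_le₀ hx.2 hL))

theorem memW41_zero (hL : 0 < L) : MemW41 L 0 := by
  have hzero : sineArc L 0 = 0 := funext fun _ => zero_mul _
  exact hzero ▸ memW41_sineArc hL 0

theorem navierBC_zero (L : ℝ) : NavierBC L 0 := by simp [NavierBC, D_zero_right]

theorem zero_below_sineArc (hL : 0 < L) (hlam : 0 ≤ lam) : Below L 0 (sineArc L lam) :=
  fun x hx => by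
    have hsin := sin_pi_div_mul_nonneg hx
    rw [D_zero_right, D_two_sineArc hL lam hx]
    exact ⟨mul_nonneg hlam hsin, neg_nonpos.2 (mul_nonneg (sineArcCurvature_nonneg hlam) hsin)⟩

/-- The sector `[0, β]` of the theorem, with `β x = λ sin (π x / L)`. -/
abbrev sineSector (L lam : ℝ) : Set (ℝ → ℝ) := Sector L 0 (sineArc L lam)

namespace sineSector

theorem zero_mem (hL : 0 < L) (hlam : 0 ≤ lam) : 0 ∈ sineSector L lam :=
  mem_sector_iff.2 ⟨contDiffOn_const, .refl _ _, zero_below_sineArc hL hlam⟩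

theorem sineArc_mem (hL : 0 < L) (hlam : 0 ≤ lam) : sineArc L lam ∈ sineSector L lam :=
  mem_sector_iff.2 ⟨(memW41_sineArc hL lam).contDiffOn_two, zero_below_sineArc hL hlam, .refl _ _⟩

theorem zero_below (hu : u ∈ sineSector L lam) : Below L 0 u := (mem_sector_iff.1 hu).2.1

theorem below_sineArc (hu : u ∈ sineSector L lam) : Below L u (sineArc L lam) :=
  (mem_sector_iff.1 hu).2.2

theorem hasDirichletSecondDeriv (hL : 0 < L) (hu : u ∈ sineSector L lam) :
    HasDirichletSecondDeriv L u (D L 1 u) (D L 2 u) := by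
  have hleft := (hu.2 0 (left_mem_Icc.2 hL.le)).1
  have hright := (hu.2 L (right_mem_Icc.2 hL.le)).1
  rw [sineArc_left] at hleft
  rw [sineArc_right hL.ne'] at hright
  exact ⟨hasSecondDeriv_of_contDiffOn hL hu.1, le_antisymm hleft.2 hleft.1,
    le_antisymm hright.2 hright.1⟩

theorem D_two_nonpos (hu : u ∈ sineSector L lam) (hx : x ∈ Icc 0 L) : D L 2 u x ≤ 0 := by
  simpa [D_zero_right] using (hu.2 x hx).2.1

theorem neg_curvature_le_D_two (hL : 0 < L) (hlam : 0 ≤ lam) (hu : u ∈ sineSector L lam)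
    (hx : x ∈ Icc 0 L) : -sineArcCurvature L lam ≤ D L 2 u x := by
  refine le_trans ?_ (hu.2 x hx).2.2
  rw [D_two_sineArc hL lam hx, neg_le_neg_iff]
  exact mul_le_of_le_one_right (sineArcCurvature_nonneg hlam) (Real.sin_le_one _)

theorem abs_D_two_le (hL : 0 < L) (hlam : 0 ≤ lam) (hu : u ∈ sineSector L lam)
    (hx : x ∈ Icc 0 L) : |D L 2 u x| ≤ sineArcCurvature L lam :=
  abs_le.2 ⟨neg_curvature_le_D_two hL hlam hu hx,
    (D_two_nonpos hu hx).trans (sineArcCurvature_nonneg hlam)⟩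

theorem intervalIntegrable (hL : 0 ≤ L) (hu : u ∈ sineSector L lam) :
    IntervalIntegrable u volume 0 L :=
  hu.1.continuousOn.intervalIntegrable_of_Icc hL

theorem continuousOn_D_two (hL : 0 < L) (hu : u ∈ sineSector L lam) :
    ContinuousOn (D L 2 u) (Icc 0 L) :=
  continuousOn_D hL (n := 2) (by exact_mod_cast hu.1) le_rfl

theorem intervalIntegrable_D_two (hL : 0 < L) (hu : u ∈ sineSector L lam) :
    IntervalIntegrable (D L 2 u) volume 0 L :=
  (continuousOn_D_two hL hu).intervalIntegrable_of_Icc hL.le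

theorem integral_nonneg (hL : 0 ≤ L) (hu : u ∈ sineSector L lam) : 0 ≤ ∫ t in (0 : ℝ)..L, u t :=
  intervalIntegral.integral_nonneg hL fun x hx => (hu.2 x hx).1.1

theorem integral_le (hL : 0 < L) (hlam : 0 ≤ lam) (hu : u ∈ sineSector L lam) :
    ∫ t in (0 : ℝ)..L, u t ≤ sineArcIntegral L lam := by
  rw [← integral_sineArc hL.ne']
  exact (below_sineArc hu).integral_le hL.le (intervalIntegrable hL.le hu)
    (intervalIntegrable hL.le (sineArc_mem hL hlam))

end sineSector

end Sector

/-! ### The iteration -/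

section Iteration

variable {a b c lam d d' I I' x : ℝ} {p u u' v v' u₀ v₀ w : ℝ → ℝ}

/-- The coefficient `M` of the theorem. -/
def stepM (L a b lam : ℝ) : ℝ := a + 2 * b * lam * (L / Real.pi)

/-- The coefficient `N` of the theorem. -/
def stepN (L b c lam : ℝ) : ℝ := c + b * lam * (Real.pi ^ 2 / L ^ 2)

/-- With `κ = max (-β'')` and `K = ∫ β`, the right-hand side of the iteration is
`p + b (K (-u'') + κ ∫ u + u'' ∫ u)`. This is the factor of `b`, as a function of `d = u'' x` and
`I = ∫ u`, written so that its monotonicity for `-κ ≤ d` and `I ≤ K` is visible. -/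
def feedback (L lam d I : ℝ) : ℝ :=
  sineArcCurvature L lam * sineArcIntegral L lam
    - (sineArcIntegral L lam - I) * (sineArcCurvature L lam + d)

theorem feedback_mono (hd : -sineArcCurvature L lam ≤ d') (hdd' : d' ≤ d) (hII' : I ≤ I')
    (hI : I ≤ sineArcIntegral L lam) : feedback L lam d I ≤ feedback L lam d' I' :=
  sub_le_sub_left (mul_le_mul (sub_le_sub_left hII' _) (add_le_add_right hdd' _)
    (neg_le_iff_add_nonneg'.1 hd) (sub_nonneg.2 hI)) _

theorem feedback_zero (L lam : ℝ) : feedback L lam 0 0 = 0 := by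
  simp only [feedback, sub_zero, add_zero, mul_comm, sub_self]

theorem feedback_sineArcIntegral (L lam d : ℝ) :
    feedback L lam d (sineArcIntegral L lam)
      = sineArcCurvature L lam * sineArcIntegral L lam := by
  simp only [feedback, sub_self, zero_mul, sub_zero]

theorem isStep_iff : IsStep L a b c lam p u v ↔ MemW41 L v ∧ NavierBC L v ∧
    ∀ᵐ x ∂(volume.restrict (Ioo 0 L)),
      nonlocalOp L (stepM L a b lam) (stepN L b c lam) v x
        = p x + b * feedback L lam (D L 2 u x) (∫ t in (0 : ℝ)..L, u t) := by
  have hrhs : ∀ x, p x + b * D L 2 u x * (∫ t in (0 : ℝ)..L, u t)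
      - 2 * b * lam * (L / Real.pi) * D L 2 u x
      + b * lam * (Real.pi ^ 2 / L ^ 2) * (∫ t in (0 : ℝ)..L, u t)
      = p x + b * feedback L lam (D L 2 u x) (∫ t in (0 : ℝ)..L, u t) := fun x => by
    simp only [feedback, sineArcCurvature, sineArcIntegral]
    ring
  simp only [← hrhs]
  exact ⟨fun h => ⟨h.mem, h.bc, h.eqn⟩, fun h => ⟨h.1, h.2.1, h.2.2⟩⟩

theorem isStep_self_iff : IsStep L a b c lam p w w ↔ IsSolution L a b c p w := by
  refine ⟨fun h => ⟨h.mem, h.bc, ?_⟩, fun h => ⟨h.mem, h.bc, ?_⟩⟩ <;>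
    filter_upwards [h.eqn] with x hx using by linear_combination hx

theorem IsSolution.isIteration_const (h : IsSolution L a b c p w) (lam : ℝ) :
    IsIteration L a b c lam p w fun _ => w :=
  ⟨rfl, fun _ => isStep_self_iff.2 h⟩

theorem IsIteration.shift {u : ℕ → ℝ → ℝ} (h : IsIteration L a b c lam p u₀ u) :
    IsIteration L a b c lam p (u 1) fun n => u (n + 1) :=
  ⟨rfl, fun n => h.step (n + 1)⟩

/-- The assumptions under which the iteration maps the sector `[0, β]` monotonically to itself. -/
structure Admissible (L a b c lam : ℝ) (p : ℝ → ℝ) : Prop where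
  hL : 0 < L
  ha : 0 ≤ a
  hb : 0 ≤ b
  hc : 0 ≤ c
  hlam : 0 ≤ lam
  hM : 0 < stepM L a b lam
  hp : IntegrableOn p (Ioo 0 L)
  hp0 : ∀ᵐ x ∂(volume.restrict (Ioo 0 L)), 0 ≤ p x
  hple : ∀ᵐ x ∂(volume.restrict (Ioo 0 L)),
    p x ≤ (lam * (Real.pi ^ 4 / L ^ 4) + a * lam * (Real.pi ^ 2 / L ^ 2)
        + 2 * b * lam ^ 2 * (Real.pi / L)) * Real.sin (Real.pi / L * x)
      + 2 * lam * c * (L / Real.pi)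
  hkey : stepN L b c lam ≤ 4 * stepM L a b lam / L ^ 3 * sigma (√(stepM L a b lam) * L)

namespace Admissible

variable (H : Admissible L a b c lam p)
include H

theorem stepN_nonneg : 0 ≤ stepN L b c lam := by
  have := H.hb; have := H.hc; have := H.hlam
  unfold stepN; positivity

theorem below_of_step_le (hu : MemW41 L u) (hv : MemW41 L v) (hub : NavierBC L u)
    (hvb : NavierBC L v)
    (h : ∀ᵐ x ∂(volume.restrict (Ioo 0 L)), nonlocalOp L (stepM L a b lam) (stepN L b c lam) u x
      ≤ nonlocalOp L (stepM L a b lam) (stepN L b c lam) v x) : Below L u v :=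
  .of_nonlocalOp_le H.hL H.hM H.stepN_nonneg H.hkey hu hv hub hvb h

theorem intervalIntegrable_p : IntervalIntegrable p volume 0 L :=
  (intervalIntegrable_iff_integrableOn_Ioo_of_le H.hL.le).2 H.hp

theorem intervalIntegrable_forcing {W : ℝ → ℝ} (hW : IntervalIntegrable W volume 0 L) (I : ℝ) :
    IntervalIntegrable (fun x => p x + b * feedback L lam (W x) I) volume 0 L :=
  H.intervalIntegrable_p.add ((intervalIntegrable_const.sub
    ((intervalIntegrable_const.add hW).const_mul _)).const_mul b)

theorem exists_step (hu : u ∈ sineSector L lam) : ∃ v, IsStep L a b c lam p u v := by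
  simp only [isStep_iff]
  exact exists_nonlocalOp_eq H.hL H.hM H.stepN_nonneg
    (H.intervalIntegrable_forcing (sineSector.intervalIntegrable_D_two H.hL hu) _)

theorem mul_feedback_mono (hu : u ∈ sineSector L lam) (hv : v ∈ sineSector L lam)
    (h : Below L u v) (hx : x ∈ Icc 0 L) :
    b * feedback L lam (D L 2 u x) (∫ t in (0 : ℝ)..L, u t)
      ≤ b * feedback L lam (D L 2 v x) (∫ t in (0 : ℝ)..L, v t) :=
  mul_le_mul_of_nonneg_left
    (feedback_mono (sineSector.neg_curvature_le_D_two H.hL H.hlam hv hx) (h x hx).2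
      (h.integral_le H.hL.le (sineSector.intervalIntegrable H.hL.le hu)
        (sineSector.intervalIntegrable H.hL.le hv))
      (sineSector.integral_le H.hL H.hlam hu)) H.hb

theorem mul_feedback_mem_Icc (hu : u ∈ sineSector L lam) (hx : x ∈ Icc 0 L) :
    b * feedback L lam (D L 2 u x) (∫ t in (0 : ℝ)..L, u t)
      ∈ Icc 0 (b * (sineArcCurvature L lam * sineArcIntegral L lam)) := by
  have hlower := H.mul_feedback_mono (sineSector.zero_mem H.hL H.hlam) hu
    (sineSector.zero_below hu) hx
  have hupper := H.mul_feedback_mono hu (sineSector.sineArc_mem H.hL H.hlam)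
    (sineSector.below_sineArc hu) hx
  rw [integral_sineArc H.hL.ne', feedback_sineArcIntegral] at hupper
  simp only [D_zero_right, Pi.zero_apply, intervalIntegral.integral_zero, feedback_zero,
    mul_zero] at hlower
  exact ⟨hlower, hupper⟩

theorem step_mono (hu : u ∈ sineSector L lam) (hv : v ∈ sineSector L lam) (h : Below L u v)
    (hu' : IsStep L a b c lam p u u') (hv' : IsStep L a b c lam p v v') : Below L u' v' := by
  refine H.below_of_step_le hu'.mem hv'.mem hu'.bc hv'.bc ?_
  filter_upwards [(isStep_iff.1 hu').2.2, (isStep_iff.1 hv').2.2,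
    ae_restrict_mem measurableSet_Ioo] with x hxu hxv hx
  rw [hxu, hxv]
  exact add_le_add_right (H.mul_feedback_mono hu hv h (Ioo_subset_Icc_self hx)) _

theorem zero_below_step (hu : u ∈ sineSector L lam) (hu' : IsStep L a b c lam p u u') :
    Below L 0 u' := by
  refine H.below_of_step_le (memW41_zero H.hL) hu'.mem (navierBC_zero L) hu'.bc ?_
  filter_upwards [(isStep_iff.1 hu').2.2, H.hp0, ae_restrict_mem measurableSet_Ioo]
    with x hxu hpx hx
  rw [hxu]
  simpa [nonlocalOp, D_zero_right] using
    add_nonneg hpx (H.mul_feedback_mem_Icc hu (Ioo_subset_Icc_self hx)).1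

theorem step_below_sineArc (hu : u ∈ sineSector L lam) (hu' : IsStep L a b c lam p u u') :
    Below L u' (sineArc L lam) := by
  refine H.below_of_step_le hu'.mem (memW41_sineArc H.hL lam) hu'.bc
    (navierBC_sineArc H.hL lam) ?_
  filter_upwards [(isStep_iff.1 hu').2.2, H.hple, D_four_sineArc H.hL lam,
    ae_restrict_mem measurableSet_Ioo] with x hxu hpx hD₄ hx
  have hx' := Ioo_subset_Icc_self hx
  have hmax : b * (sineArcCurvature L lam * sineArcIntegral L lam)
      = 2 * b * lam ^ 2 * (Real.pi / L) := by
    have := H.hL.ne'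
    unfold sineArcCurvature sineArcIntegral
    field_simp
  calc nonlocalOp L (stepM L a b lam) (stepN L b c lam) u' x
      ≤ p x + b * (sineArcCurvature L lam * sineArcIntegral L lam) :=
        hxu.trans_le (add_le_add_right (H.mul_feedback_mem_Icc hu hx').2 _)
    _ ≤ nonlocalOp L (stepM L a b lam) (stepN L b c lam) (sineArc L lam) x := by
        rw [nonlocalOp, hD₄, D_two_sineArc H.hL lam hx', integral_sineArc H.hL.ne', stepM, stepN]
        unfold sineArcCurvature sineArcIntegral at hmax ⊢
        linear_combination hpx - Real.sin (Real.pi / L * x) * hmax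

theorem step_mem_sineSector (hu : u ∈ sineSector L lam) (hu' : IsStep L a b c lam p u u') :
    u' ∈ sineSector L lam :=
  mem_sector_iff.2
    ⟨hu'.mem.contDiffOn_two, H.zero_below_step hu hu', H.step_below_sineArc hu hu'⟩

theorem iteration_mem_sineSector {u : ℕ → ℝ → ℝ} (hu₀ : u₀ ∈ sineSector L lam)
    (hu : IsIteration L a b c lam p u₀ u) (n : ℕ) : u n ∈ sineSector L lam := by
  induction n with
  | zero => rwa [hu.init]
  | succ n ih => exact H.step_mem_sineSector ih (hu.step n)

theorem iteration_mono {u v : ℕ → ℝ → ℝ} (hu₀ : u₀ ∈ sineSector L lam)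
    (hv₀ : v₀ ∈ sineSector L lam) (hu : IsIteration L a b c lam p u₀ u)
    (hv : IsIteration L a b c lam p v₀ v) (h : Below L u₀ v₀) (n : ℕ) : Below L (u n) (v n) := by
  induction n with
  | zero => rwa [hu.init, hv.init]
  | succ n ih =>
    exact H.step_mono (H.iteration_mem_sineSector hu₀ hu n) (H.iteration_mem_sineSector hv₀ hv n)
      ih (hu.step n) (hv.step n)

theorem exists_iteration (hu₀ : u₀ ∈ sineSector L lam) :
    ∃ u, IsIteration L a b c lam p u₀ u := by
  choose F hF using fun u : sineSector L lam => H.exists_step u.2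
  let step : sineSector L lam → sineSector L lam :=
    fun u => ⟨F u, H.step_mem_sineSector u.2 (hF u)⟩
  refine ⟨fun n => (step^[n] ⟨u₀, hu₀⟩ : sineSector L lam), rfl, fun n => ?_⟩
  rw [Function.iterate_succ_apply']
  exact hF _

end Admissible

end Iteration

/-! ### Limits of the iteration -/

section Limit

theorem tendsto_integral_of_dominated (hL : 0 ≤ L) {bound f : ℝ → ℝ} {F : ℕ → ℝ → ℝ}
    (hF : ∀ n, IntervalIntegrable (F n) volume 0 L) (hbound : IntervalIntegrable bound volume 0 L)
    (hle : ∀ n, ∀ x ∈ Icc 0 L, |F n x| ≤ bound x)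
    (hlim : ∀ x ∈ Icc 0 L, Tendsto (fun n => F n x) atTop (𝓝 (f x))) :
    Tendsto (fun n => ∫ s in (0 : ℝ)..L, F n s) atTop (𝓝 (∫ s in (0 : ℝ)..L, f s)) := by
  have hsub : ∀ ⦃x⦄, x ∈ uIoc 0 L → x ∈ Icc 0 L := by
    rw [uIoc_of_le hL]
    exact Ioc_subset_Icc_self
  exact intervalIntegral.tendsto_integral_filter_of_dominated_convergence bound
    (.of_forall fun n => (hF n).def'.aestronglyMeasurable)
    (.of_forall fun n => .of_forall fun x hx => hle n x (hsub hx)) hbound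
    (.of_forall fun x hx => hlim x (hsub hx))

theorem tendsto_integral_mul_of_dominated (hL : 0 ≤ L) {k bound f : ℝ → ℝ} {F : ℕ → ℝ → ℝ}
    (hk : Continuous k) (hF : ∀ n, IntervalIntegrable (F n) volume 0 L)
    (hbound : IntervalIntegrable bound volume 0 L) (hle : ∀ n, ∀ x ∈ Icc 0 L, |F n x| ≤ bound x)
    (hlim : ∀ x ∈ Icc 0 L, Tendsto (fun n => F n x) atTop (𝓝 (f x))) :
    Tendsto (fun n => ∫ s in (0 : ℝ)..L, k s * F n s) atTop (𝓝 (∫ s in (0 : ℝ)..L, k s * f s)) :=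
  tendsto_integral_of_dominated hL (fun n => (hF n).continuousOn_mul hk.continuousOn)
    (hbound.continuousOn_mul hk.abs.continuousOn)
    (fun n x hx => (abs_mul _ _).trans_le (mul_le_mul_of_nonneg_left (hle n x hx) (abs_nonneg _)))
    fun x hx => (hlim x hx).const_mul _

theorem intervalIntegrable_of_tendsto {C : ℝ} (hL : 0 ≤ L) {f : ℝ → ℝ} {F : ℕ → ℝ → ℝ}
    (hF : ∀ n, IntervalIntegrable (F n) volume 0 L) (hle : ∀ n, ∀ x ∈ Icc 0 L, |F n x| ≤ C)
    (hlim : ∀ x ∈ Icc 0 L, Tendsto (fun n => F n x) atTop (𝓝 (f x))) :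
    IntervalIntegrable f volume 0 L := by
  rw [intervalIntegrable_iff_integrableOn_Icc_of_le hL]
  have hmeas : AEStronglyMeasurable f (volume.restrict (Icc 0 L)) :=
    aestronglyMeasurable_of_tendsto_ae atTop
      (fun n => ((intervalIntegrable_iff_integrableOn_Icc_of_le hL).1 (hF n)).aestronglyMeasurable)
      (ae_restrict_of_forall_mem measurableSet_Icc hlim)
  exact (integrable_const C).mono' hmeas <| ae_restrict_of_forall_mem measurableSet_Icc
    fun x hx => le_of_tendsto (hlim x hx).abs (.of_forall fun n => hle n x hx)

variable {a b c lam : ℝ} {p y z u₀ W : ℝ → ℝ} {u : ℕ → ℝ → ℝ}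

namespace sineSector

theorem tendsto_integral_arch (hL : 0 < L) (hlam : 0 ≤ lam) (hu : ∀ n, u n ∈ sineSector L lam)
    (hlim : ∀ x ∈ Icc 0 L, Tendsto (fun n => D L 2 (u n) x) atTop (𝓝 (W x))) :
    Tendsto (fun n => ∫ t in (0 : ℝ)..L, u n t) atTop (𝓝 (-∫ s in (0 : ℝ)..L, arch L s * W s)) := by
  have hrep : ∀ n, ∫ t in (0 : ℝ)..L, u n t = -∫ s in (0 : ℝ)..L, arch L s * D L 2 (u n) s :=
    fun n => by rw [(hasDirichletSecondDeriv hL (hu n)).integral_arch_mul_deriv₂ hL.le, neg_neg]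
  simp only [hrep]
  exact (tendsto_integral_mul_of_dominated hL.le (continuous_arch L)
    (fun n => intervalIntegrable_D_two hL (hu n)) intervalIntegrable_const
    (fun n x hx => abs_D_two_le hL hlam (hu n) hx) hlim).neg

theorem of_tendsto_D_two (hL : 0 < L) (hlam : 0 ≤ lam) (hu : ∀ n, u n ∈ sineSector L lam)
    (hy : MemW41 L y) (hbc : NavierBC L y)
    (hlim : ∀ x ∈ Icc 0 L, Tendsto (fun n => D L 2 (u n) x) atTop (𝓝 (D L 2 y x))) :
    y ∈ sineSector L lam := by
  have hy₂ := hy.hasDirichletSecondDeriv hL hbc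
  refine mem_sector_iff.2 ⟨hy.contDiffOn_two, ?_, ?_⟩
  · exact .of_D_two_le hL (hasDirichletSecondDeriv hL (zero_mem hL hlam)) hy₂ fun x hx =>
      le_of_tendsto (hlim x hx) (.of_forall fun n => (zero_below (hu n) x hx).2)
  · exact .of_D_two_le hL hy₂ (hasDirichletSecondDeriv hL (sineArc_mem hL hlam)) fun x hx =>
      ge_of_tendsto (hlim x hx) (.of_forall fun n => (below_sineArc (hu n) x hx).2)

theorem tendstoUniformlyOn (hL : 0 < L) (hlam : 0 ≤ lam) (hu : ∀ n, u n ∈ sineSector L lam)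
    (hy : y ∈ sineSector L lam)
    (hlim : ∀ x ∈ Icc 0 L, Tendsto (fun n => D L 2 (u n) x) atTop (𝓝 (D L 2 y x))) :
    TendstoUniformlyOn u y atTop (Icc 0 L) := by
  have hzero : Tendsto (fun n => L * ∫ s in (0 : ℝ)..L, |D L 2 y s - D L 2 (u n) s|) atTop
      (𝓝 (L * ∫ _ in (0 : ℝ)..L, 0)) := by
    refine (tendsto_integral_of_dominated hL.le (fun n => ((intervalIntegrable_D_two hL hy).sub
      (intervalIntegrable_D_two hL (hu n))).abs)
      (bound := fun _ => sineArcCurvature L lam + sineArcCurvature L lam) intervalIntegrable_const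
      (fun n x hx => ?_) fun x hx => ?_).const_mul L
    · rw [abs_abs]
      exact (abs_sub _ _).trans
        (add_le_add (abs_D_two_le hL hlam hy hx) (abs_D_two_le hL hlam (hu n) hx))
    · simpa using ((hlim x hx).const_sub (D L 2 y x)).abs
  rw [intervalIntegral.integral_zero, mul_zero] at hzero
  rw [Metric.tendstoUniformlyOn_iff]
  intro ε hε
  filter_upwards [hzero.eventually_lt_const hε] with n hn x hx
  exact (((hasDirichletSecondDeriv hL hy).sub
    (hasDirichletSecondDeriv hL (hu n))).abs_le_mul_integral_abs_deriv₂ hL hx).trans_lt hn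

end sineSector

namespace IsSolution

theorem below_symm (hL : 0 < L) (ha : 0 ≤ a) (hb : 0 ≤ b) (hc : 0 ≤ c)
    (hy : IsSolution L a b c p y) (hz : IsSolution L a b c p z) (hys : y ∈ sineSector L lam)
    (hzs : z ∈ sineSector L lam) (h : Below L y z) : Below L z y := by
  refine .of_D_two_le hL (hz.mem.hasDirichletSecondDeriv hL hz.bc)
    (hy.mem.hasDirichletSecondDeriv hL hy.bc) fun x hx => ?_
  refine (hy.mem.hasDirichletSecondDeriv_D_two hL hy.bc).le_of_deriv₂_ge hL
    (hz.mem.hasDirichletSecondDeriv_D_two hL hz.bc) ?_ hx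
  have hIJ := h.integral_le hL.le (sineSector.intervalIntegrable hL.le hys)
    (sineSector.intervalIntegrable hL.le hzs)
  have hJ := sineSector.integral_nonneg hL.le hzs
  filter_upwards [hy.eqn, hz.eqn, ae_restrict_mem measurableSet_Ioo] with s heqy heqz hs
  have hs' := Ioo_subset_Icc_self hs
  have hyz := (h s hs').2
  have hy₂ := sineSector.D_two_nonpos hys hs'
  set I := ∫ t in (0 : ℝ)..L, y t
  set J := ∫ t in (0 : ℝ)..L, z t
  have hcoeff : 0 ≤ a + b * J := add_nonneg ha (mul_nonneg hb hJ)
  calc D L 4 z s = p s + (a + b * J) * D L 2 z s - c * J := by linear_combination heqz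
    _ ≤ p s + (a + b * J) * D L 2 y s - c * J :=
        sub_le_sub_right (add_le_add_right (mul_le_mul_of_nonneg_left hyz hcoeff) _) _
    _ ≤ p s + (a + b * I) * D L 2 y s - c * I :=
        sub_le_sub (add_le_add_right (mul_le_mul_of_nonpos_right (by gcongr) hy₂) _) (by gcongr)
    _ = D L 4 y s := by linear_combination -heqy

theorem ae_eq_zero_of_eqOn_zero (hy : IsSolution L a b c p y) (hL : 0 ≤ L)
    (h : EqOn y 0 (Icc 0 L)) : p =ᵐ[volume.restrict (Ioo 0 L)] 0 := by
  have hI : ∫ t in (0 : ℝ)..L, y t = 0 := by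
    rw [intervalIntegral.integral_congr (g := 0) (by rwa [uIcc_of_le hL])]
    exact intervalIntegral.integral_zero
  filter_upwards [hy.eqn, ae_restrict_mem measurableSet_Ioo] with s heq hs
  have hs' := Ioo_subset_Icc_self hs
  rw [hI, D_congr h 4 hs', D_congr h 2 hs', D_zero_right, D_zero_right] at heq
  simpa using heq.symm

theorem pos (hy : IsSolution L a b c p y) (hys : y ∈ sineSector L lam)
    (hpne : ¬ p =ᵐ[volume.restrict (Ioo 0 L)] 0) {x : ℝ} (hx : x ∈ Ioo 0 L) : 0 < y x := by
  have hL : 0 < L := hx.1.trans hx.2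
  have hy₂ := sineSector.hasDirichletSecondDeriv hL hys
  obtain ⟨s, hs, hneg⟩ : ∃ s ∈ Ioo 0 L, D L 2 y s < 0 := by
    by_contra! hflat
    refine hpne (hy.ae_eq_zero_of_eqOn_zero hL.le fun t ht => le_antisymm ?_ (hys.2 t ht).1.1)
    have hzero := hy₂.sub hy₂
    simp only [sub_self] at hzero
    exact hy₂.le_of_deriv₂_ge hL hzero (ae_restrict_of_forall_mem measurableSet_Ioo hflat) ht
  exact hy₂.pos_of_deriv₂_nonpos (sineSector.continuousOn_D_two hL hys)
    (fun t ht => sineSector.D_two_nonpos hys ht) hs hneg hx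

end IsSolution

theorem IterationConverges.eqOn_of_isSolution {w : ℝ → ℝ}
    (h : IterationConverges L a b c lam p w y) (hw : IsSolution L a b c p w) :
    EqOn w y (Icc 0 L) := fun _ hx =>
  tendsto_nhds_unique tendsto_const_nhds ((h.tendsto _ (hw.isIteration_const lam)).tendsto_at hx)

namespace Admissible

variable (H : Admissible L a b c lam p)
include H

theorem neg_D_two_eq_integral {f y : ℝ → ℝ} (hy : MemW41 L y) (hbc : NavierBC L y)
    (heq : ∀ᵐ x ∂(volume.restrict (Ioo 0 L)),
      nonlocalOp L (stepM L a b lam) (stepN L b c lam) y x = f x) {x : ℝ} (hx : x ∈ Icc 0 L) :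
    -D L 2 y x = ∫ s in (0 : ℝ)..L,
      nonlocalKernel L (√(stepM L a b lam)) (stepN L b c lam) x s * f s := by
  rw [hy.neg_D_two_eq_integral H.hL (Real.sqrt_pos.2 H.hM) H.stepN_nonneg hbc hx,
    Real.sq_sqrt H.hM.le]
  refine integral_congr_ae_Ioo le_rfl H.hL.le le_rfl ?_
  filter_upwards [heq] with s hs
  rw [hs]

theorem tendsto_integral_kernel_forcing (hu : ∀ n, u n ∈ sineSector L lam) {k : ℝ → ℝ} {I : ℝ}
    (hk : Continuous k) (hI : Tendsto (fun n => ∫ t in (0 : ℝ)..L, u n t) atTop (𝓝 I))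
    (hlim : ∀ x ∈ Icc 0 L, Tendsto (fun n => D L 2 (u n) x) atTop (𝓝 (W x))) :
    Tendsto (fun n => ∫ s in (0 : ℝ)..L,
        k s * (p s + b * feedback L lam (D L 2 (u n) s) (∫ t in (0 : ℝ)..L, u n t))) atTop
      (𝓝 (∫ s in (0 : ℝ)..L, k s * (p s + b * feedback L lam (W s) I))) := by
  refine tendsto_integral_mul_of_dominated H.hL.le hk
    (bound := fun s => |p s| + b * (sineArcCurvature L lam * sineArcIntegral L lam))
    (fun n => H.intervalIntegrable_forcing (sineSector.intervalIntegrable_D_two H.hL (hu n)) _)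
    (H.intervalIntegrable_p.abs.add intervalIntegrable_const) (fun n s hs => ?_) fun s hs => ?_
  · have hfeedback := H.mul_feedback_mem_Icc (hu n) hs
    refine (abs_add_le _ _).trans (add_le_add_right ?_ _)
    rw [abs_of_nonneg hfeedback.1]
    exact hfeedback.2
  · exact ((((hI.const_sub _).mul ((hlim s hs).const_add _)).const_sub _).const_mul b).const_add _

theorem exists_limit_solution (hu₀ : u₀ ∈ sineSector L lam)
    (hu : IsIteration L a b c lam p u₀ u)
    (hlim : ∀ x ∈ Icc 0 L, Tendsto (fun n => D L 2 (u n) x) atTop (𝓝 (W x))) :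
    ∃ y, IsSolution L a b c p y ∧ y ∈ sineSector L lam ∧ EqOn W (D L 2 y) (Icc 0 L) := by
  have hmem := H.iteration_mem_sineSector hu₀ hu
  set I := -∫ s in (0 : ℝ)..L, arch L s * W s
  have hI : Tendsto (fun n => ∫ t in (0 : ℝ)..L, u n t) atTop (𝓝 I) :=
    sineSector.tendsto_integral_arch H.hL H.hlam hmem hlim
  have hW : IntervalIntegrable W volume 0 L := intervalIntegrable_of_tendsto H.hL.le
    (fun n => sineSector.intervalIntegrable_D_two H.hL (hmem n))
    (fun n x hx => sineSector.abs_D_two_le H.hL H.hlam (hmem n) hx) hlim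
  obtain ⟨y, hy, hbc, heq⟩ :=
    exists_nonlocalOp_eq H.hL H.hM H.stepN_nonneg (H.intervalIntegrable_forcing hW I)
  have hWy : EqOn W (D L 2 y) (Icc 0 L) := fun x hx => by
    have hkernel := H.tendsto_integral_kernel_forcing hmem
      (continuous_nonlocalKernel L (√(stepM L a b lam)) (stepN L b c lam) x) hI hlim
    rw [← H.neg_D_two_eq_integral hy hbc heq hx] at hkernel
    refine neg_injective (tendsto_nhds_unique
      ((hlim x hx).comp (tendsto_add_atTop_nat 1)).neg (hkernel.congr fun n => ?_))
    exact (H.neg_D_two_eq_integral (hu.step n).mem (hu.step n).bc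
      (isStep_iff.1 (hu.step n)).2.2 hx).symm
  have hlimy : ∀ x ∈ Icc 0 L, Tendsto (fun n => D L 2 (u n) x) atTop (𝓝 (D L 2 y x)) :=
    fun x hx => hWy hx ▸ hlim x hx
  have hIy : I = ∫ t in (0 : ℝ)..L, y t := by
    rw [neg_eq_iff_eq_neg, ← (hy.hasDirichletSecondDeriv H.hL hbc).integral_arch_mul_deriv₂ H.hL.le]
    refine intervalIntegral.integral_congr fun s hs => ?_
    rw [uIcc_of_le H.hL.le] at hs
    rw [hWy hs]
  refine ⟨y, (isStep_self_iff (lam := lam)).1 (isStep_iff.2 ⟨hy, hbc, ?_⟩),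
    sineSector.of_tendsto_D_two H.hL H.hlam hmem hy hbc hlimy, hWy⟩
  filter_upwards [heq, ae_restrict_mem measurableSet_Ioo] with x hx hx'
  rwa [hWy (Ioo_subset_Icc_self hx'), hIy] at hx

theorem exists_limit_from_zero (hu : IsIteration L a b c lam p 0 u) :
    ∃ y, IsSolution L a b c p y ∧ y ∈ sineSector L lam ∧
      ∀ x ∈ Icc 0 L, Tendsto (fun n => D L 2 (u n) x) atTop (𝓝 (D L 2 y x)) := by
  have hzero := sineSector.zero_mem H.hL H.hlam
  have hmem := H.iteration_mem_sineSector hzero hu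
  have hmono := H.iteration_mono hzero (hmem 1) hu hu.shift (sineSector.zero_below (hmem 1))
  have hlim : ∀ x ∈ Icc 0 L, Tendsto (fun n => D L 2 (u n) x) atTop (𝓝 (⨅ n, D L 2 (u n) x)) :=
    fun x hx => tendsto_atTop_ciInf (antitone_nat_of_succ_le fun n => (hmono n x hx).2)
      ⟨_, forall_mem_range.2 fun n => sineSector.neg_curvature_le_D_two H.hL H.hlam (hmem n) hx⟩
  obtain ⟨y, hy, hys, hWy⟩ := H.exists_limit_solution hzero hu hlim
  exact ⟨y, hy, hys, fun x hx => hWy hx ▸ hlim x hx⟩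

theorem exists_limit_from_sineArc (hu : IsIteration L a b c lam p (sineArc L lam) u) :
    ∃ y, IsSolution L a b c p y ∧ y ∈ sineSector L lam ∧
      ∀ x ∈ Icc 0 L, Tendsto (fun n => D L 2 (u n) x) atTop (𝓝 (D L 2 y x)) := by
  have harc := sineSector.sineArc_mem H.hL H.hlam
  have hmem := H.iteration_mem_sineSector harc hu
  have hmono := H.iteration_mono (hmem 1) harc hu.shift hu (sineSector.below_sineArc (hmem 1))
  have hlim : ∀ x ∈ Icc 0 L, Tendsto (fun n => D L 2 (u n) x) atTop (𝓝 (⨆ n, D L 2 (u n) x)) :=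
    fun x hx => tendsto_atTop_ciSup (monotone_nat_of_le_succ fun n => (hmono n x hx).2)
      ⟨0, forall_mem_range.2 fun n => sineSector.D_two_nonpos (hmem n) hx⟩
  obtain ⟨y, hy, hys, hWy⟩ := H.exists_limit_solution harc hu hlim
  exact ⟨y, hy, hys, fun x hx => hWy hx ▸ hlim x hx⟩

theorem exists_solution : ∃ y, IsSolution L a b c p y ∧ y ∈ sineSector L lam ∧
    ∀ u₀ ∈ sineSector L lam, ∀ u, IsIteration L a b c lam p u₀ u →
      ∀ x ∈ Icc 0 L, Tendsto (fun n => D L 2 (u n) x) atTop (𝓝 (D L 2 y x)) := by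
  have hzero := sineSector.zero_mem H.hL H.hlam
  have harc := sineSector.sineArc_mem H.hL H.hlam
  obtain ⟨α, hα⟩ := H.exists_iteration hzero
  obtain ⟨β, hβ⟩ := H.exists_iteration harc
  obtain ⟨y, hy, hys, hylim⟩ := H.exists_limit_from_zero hα
  obtain ⟨z, hz, hzs, hzlim⟩ := H.exists_limit_from_sineArc hβ
  have hαβ := H.iteration_mono hzero harc hα hβ (zero_below_sineArc H.hL H.hlam)
  have hyz : Below L y z := .of_D_two_le H.hL (sineSector.hasDirichletSecondDeriv H.hL hys)
    (sineSector.hasDirichletSecondDeriv H.hL hzs) fun x hx =>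
      le_of_tendsto_of_tendsto' (hzlim x hx) (hylim x hx) fun n => (hαβ n x hx).2
  have hzy := hy.below_symm H.hL H.ha H.hb H.hc hz hys hzs hyz
  refine ⟨y, hy, hys, fun u₀ hu₀ u hu x hx => ?_⟩
  have hz_eq : D L 2 z x = D L 2 y x := le_antisymm (hyz x hx).2 (hzy x hx).2
  exact tendsto_of_tendsto_of_tendsto_of_le_of_le (hz_eq ▸ hzlim x hx) (hylim x hx)
    (fun n => (H.iteration_mono hu₀ harc hu hβ (sineSector.below_sineArc hu₀) n x hx).2)
    (fun n => (H.iteration_mono hzero hu₀ hα hu (sineSector.zero_below hu₀) n x hx).2)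

theorem iterationConverges (hys : y ∈ sineSector L lam) (hu₀ : u₀ ∈ sineSector L lam)
    (hlim : ∀ u, IsIteration L a b c lam p u₀ u →
      ∀ x ∈ Icc 0 L, Tendsto (fun n => D L 2 (u n) x) atTop (𝓝 (D L 2 y x))) :
    IterationConverges L a b c lam p u₀ y where
  exists_seq := H.exists_iteration hu₀
  unique_seq _ _ hu hv n := (H.iteration_mono hu₀ hu₀ hu hv (.refl _ _) n).eqOn
    (H.iteration_mono hu₀ hu₀ hv hu (.refl _ _) n)
  tendsto u hu := sineSector.tendstoUniformlyOn H.hL H.hlam (H.iteration_mem_sineSector hu₀ hu) hys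
    (hlim u hu)

end Admissible

end Limit

end Melan

end

theorem theorem5p2_general {L a b c lam : ℝ} {p : ℝ → ℝ} (H : Melan.Admissible L a b c lam p)
    (hpne : ¬ p =ᵐ[volume.restrict (Ioo 0 L)] 0) :
    ∃ y : ℝ → ℝ,
      (Melan.IsSolution L a b c p y ∧ y ∈ Melan.Sector L 0 (Melan.sineArc L lam) ∧
        ∀ x ∈ Ioo 0 L, 0 < y x) ∧
      (∀ w, Melan.IsSolution L a b c p w → w ∈ Melan.Sector L 0 (Melan.sineArc L lam) →
        EqOn w y (Icc 0 L)) ∧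
      Melan.IterationConverges L a b c lam p 0 y ∧
      Melan.IterationConverges L a b c lam p (Melan.sineArc L lam) y ∧
      ∀ u₀ ∈ Melan.Sector L 0 (Melan.sineArc L lam),
        Melan.IterationConverges L a b c lam p u₀ y := by
  obtain ⟨y, hy, hys, hlim⟩ := H.exists_solution
  have hconv := fun u₀ hu₀ => H.iterationConverges hys hu₀ (hlim u₀ hu₀)
  exact ⟨y, ⟨hy, hys, fun _ hx => hy.pos hys hpne hx⟩,
    fun w hw hws => (hconv w hws).eqOn_of_isSolution hw,
    hconv _ (Melan.sineSector.zero_mem H.hL H.hlam),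
    hconv _ (Melan.sineSector.sineArc_mem H.hL H.hlam), hconv⟩

theorem theorem5p2 (L a b c lam : ℝ) (p : ℝ → ℝ)
    (hL : 0 < L) (ha : 0 < a) (hb : 0 < b) (hc : 0 < c) (hlam : 0 < lam)
    (hp : IntegrableOn p (Ioo 0 L))
    (hp0 : ∀ᵐ x ∂(volume.restrict (Ioo 0 L)), 0 ≤ p x)
    (hple : ∀ᵐ x ∂(volume.restrict (Ioo 0 L)),
      p x ≤ (lam * (Real.pi ^ 4 / L ^ 4) + a * lam * (Real.pi ^ 2 / L ^ 2)
          + 2 * b * lam ^ 2 * (Real.pi / L)) * Real.sin (Real.pi / L * x)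
        + 2 * lam * c * (L / Real.pi))
    (hkey : c + b * lam * (Real.pi ^ 2 / L ^ 2)
      ≤ 4 * (a + 2 * b * lam * (L / Real.pi)) / L ^ 3
        * Melan.sigma (Real.sqrt (a + 2 * b * lam * (L / Real.pi)) * L))
    (hpne : ¬ p =ᵐ[volume.restrict (Ioo 0 L)] 0)
    (huniq : lam * (L ^ 3 / 4) * (2 * b / Real.pi + b * Real.pi ^ 2 / 4) ≤ 1) :
    ∃ y : ℝ → ℝ,
      -- `y` is a positive solution in the sector
      (Melan.IsSolution L a b c p y ∧ y ∈ Melan.Sector L 0 (Melan.sineArc L lam) ∧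
        ∀ x ∈ Ioo 0 L, 0 < y x) ∧
      -- it is the only solution in the sector
      (∀ w, Melan.IsSolution L a b c p w → w ∈ Melan.Sector L 0 (Melan.sineArc L lam) →
        EqOn w y (Icc 0 L)) ∧
      -- convergence of the iterations
      Melan.IterationConverges L a b c lam p 0 y ∧
      Melan.IterationConverges L a b c lam p (Melan.sineArc L lam) y ∧
      ∀ u₀ ∈ Melan.Sector L 0 (Melan.sineArc L lam),
        Melan.IterationConverges L a b c lam p u₀ y :=
  theorem5p2_general ⟨hL, ha.le, hb.le, hc.le, hlam.le,
    by unfold Melan.stepM; positivity, hp, hp0, hple, hkey⟩ hpne
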